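/- **Notation.** Let $n\ge 1$, $M\in\mathbb R$ (the mass), $\beta=(\beta_1,\dots,\beta_{2n})\in\mathbb C^{2n}$, $B_j=e^{-\beta_j}$, $A_a=e^{-\alpha_a}$, and $V=\mathbb Cv_+\oplus\mathbb Cv_-$. For $S\subset\{1,\dots,2n\}$ put $v_S=v_{\epsilon_1}\otimes\cdots\otimes v_{\epsilon_{2n}}\in V^{\otimes 2n}$ with $\epsilon_i=-$ exactly for $i\in S$. Let $$\phi(\alpha)=\prod_{j=1}^{2n}\frac{\Gamma\big(\frac{\alpha-\beta_j+\pi i}{-2\pi i}\big)}{\Gamma\big(\frac{\alpha-\beta_j}{-2\pi i}\big)},$$ and, for $S=\{m_1<\dots<m_n\}$, let $w_S=\mathrm{Asym}\,g_S$ (the sum over $\sigma\in S_n$ of $\mathrm{sgn}(\sigma)\,g_S(\alpha_{\sigma(1)},\dots,\alpha_{\sigma(n)})$), where $$g_S=\prod_{a=1}^{n}\Big(\frac1{\alpha_a-\beta_{m_a}}\prod_{j<m_a}\frac{\alpha_a-\beta_j+\pi i}{\alpha_a-\beta_j}\Big)\prod_{1\le a<b\le n}(\alpha_a-\alpha_b+\pi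 i).$$ Let $C$ be a simple piecewise $C^1$ curve in $\mathbb C$ from $-\infty$ to $+\infty$ (horizontal near both ends) such that all points $\beta_j-\pi i+2\pi i k$ lie above $C$ and all points $\beta_j-2\pi i k$ lie below $C$ ($1\le j\le 2n$, $k=0,1,2,\dots$). For a polynomial $P$ in $A_1,\dots,A_n$ put $$\Psi_P=\sum_{\#S=n}v_S\int_{C^n}\prod_{a=1}^n d\alpha_a\,\prod_{a=1}^n\phi(\alpha_a)\;w_S\;\frac{P(A_1,\dots,A_n)}{\prod_{a=1}^{n}\prod_{j=1}^{2n}(1-A_aB_j^{-1})}.$$ Let $\Gamma_2(x|\omega_1,\omega_2)=\exp\big(\partial_s\zeta_2(s,x|\omega_1,\omega_2)|_{s=0}\big)$ be the double gamma function, where $\zeta_2(s,x|\omega_1,\omega_2)=\sum_{k,l\ge0}(x+k\omega_1+l\omega_2)^{-s}$, continued meromorphically in $s$ and $x$; write $\Gamma_2(x)=\Gamma_2(x|2\pi,2\pi)$ and $$\zeta(\beta)=\frac{\Gamma_2(-i\beta+3\pi)\,\Gamma_2(i\beta+\pi)}{\Gamma_2(-i\beta+2\pi)\,\Gamma_2(i\beta)}.$$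 For $\mu,\nu\in\{0,1\}$ let $$P_{\mu\nu}=c_{2n}\Big(\sum_{j=1}^{2n}B_j^{-1}-(-1)^\nu\sum_{j=1}^{2n}B_j\Big)\Big((-1)^{\mu+n}\prod_{j=1}^{2n}B_j\prod_{a=1}^{n-1}A_a^{2a-1}+\prod_{a=1}^{n-1}A_a^{2a+1}\Big),$$ regarded as a polynomial in $A_1,\dots,A_n$ (not involving $A_n$), where $c_{2n}=-\big(\tfrac{-2\pi}{\zeta(-\pi i)}\big)^{n-1}(-2\pi i)^{2n(1-n)}$, and let the $2n$-particle form factor of the energy–momentum tensor $T_{\mu\nu}$ be $$f_{\mu\nu}(\beta)=-\frac{M^2}{32\pi^2\zeta(-\pi i)}\;e^{\frac n2\sum_{j}\beta_j}\prod_{1\le j<j'\le 2n}\zeta(\beta_j-\beta_{j'})\;\Psi_{P_{\mu\nu}}\in V^{\otimes 2n}.$$ At a space-time point $x=(x_0,x_1)\in\mathbb R^2$ the form factor is $e^{-i(x_0p_0+x_1p_1)}f_{\mu\nu}(\beta)$ with $p_0=M\sum_j\cosh\beta_j$, $p_1=M\sum_j\sinh\beta_j$; thus $\partial_\kappa=\partial/\partial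 x_\kappa$ acts on it as multiplication by $-ip_\kappa$. **Proposition.** For every $n\ge1$, every $\beta$ and every such contour $C$, the integrals defining $\Psi_{P_{\mu\nu}}$ converge absolutely, and for all $\mu,\nu\in\{0,1\}$: 1. $f_{\mu\nu}=f_{\nu\mu}$; 2. $\partial_0f_{0\nu}-\partial_1f_{1\nu}=0$ (at every space-time point $x$). -/

import Mathlib

open scoped TensorProduct

noncomputable section

namespace SU2ITM

/-! ### The double gamma function and the scalar factor `ζ(β)` -/

/-- `Γ₁(x | ω) = ω^{x/ω - 1/2} Γ(x/ω) / √(2π)`. -/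
def gammaOne (x ω : ℂ) : ℂ :=
  ω ^ (x / ω - 1 / 2) / (Real.sqrt (2 * Real.pi) : ℂ) * Complex.Gamma (x / ω)

/-- The generating function
`e^{-xt} / ((1 - e^{-ω₁t}) (1 - e^{-ω₂t})) = ∑_{k,l ≥ 0} e^{-(x + kω₁ + lω₂)t}`. -/
def dgKernel (x ω₁ ω₂ : ℂ) (t : ℝ) : ℂ :=
  Complex.exp (-x * t) / ((1 - Complex.exp (-ω₁ * t)) * (1 - Complex.exp (-ω₂ * t)))

/-- Coefficient of `t⁻²` in the Laurent expansion of `dgKernel` at `t = 0`. -/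
def dgCoeffNegTwo (ω₁ ω₂ : ℂ) : ℂ := 1 / (ω₁ * ω₂)

/-- Coefficient of `t⁻¹` in the Laurent expansion of `dgKernel` at `t = 0`. -/
def dgCoeffNegOne (x ω₁ ω₂ : ℂ) : ℂ := (ω₁ + ω₂ - 2 * x) / (2 * (ω₁ * ω₂))

/-- Coefficient of `t⁰` in the Laurent expansion of `dgKernel` at `t = 0`. -/
def dgCoeffZero (x ω₁ ω₂ : ℂ) : ℂ :=
  (x ^ 2 - x * (ω₁ + ω₂)) / (2 * (ω₁ * ω₂)) + 1 / 4 + (ω₁ ^ 2 + ω₂ ^ 2) / (12 * (ω₁ * ω₂))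

/-- `log Γ₂(x | ω₁, ω₂)` for `Re x > 0`, `Re ω₁ > 0`, `Re ω₂ > 0`.  This is the derivative at
`s = 0` of the Barnes zeta function `ζ₂(s, x | ω₁, ω₂) = ∑_{k,l ≥ 0} (x + kω₁ + lω₂)^{-s}
= Γ(s)⁻¹ ∫₀^∞ t^{s-1} dgKernel(t) dt`, continued to `s = 0` by subtracting the polar and
constant parts of the kernel on `(0, 1)`. -/
def logDoubleGamma (x ω₁ ω₂ : ℂ) : ℂ :=
  (∫ t in (0 : ℝ)..1,
      (dgKernel x ω₁ ω₂ t - dgCoeffNegTwo ω₁ ω₂ / (t : ℂ) ^ 2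
        - dgCoeffNegOne x ω₁ ω₂ / (t : ℂ) - dgCoeffZero x ω₁ ω₂) / (t : ℂ))
    + (∫ t in Set.Ioi (1 : ℝ), dgKernel x ω₁ ω₂ t / (t : ℂ))
    - dgCoeffNegTwo ω₁ ω₂ / 2 - dgCoeffNegOne x ω₁ ω₂
    + (Real.eulerMascheroniConstant : ℂ) * dgCoeffZero x ω₁ ω₂

/-- Number of shifts by `ω₁` which bring `x` into the right half plane. -/
def dgShift (x ω₁ : ℂ) : ℕ := ⌊-x.re / ω₁.re⌋₊ + 1

/-- The double gamma function `Γ₂(x | ω₁, ω₂)`, `Re ωᵢ > 0`, continued from `Re x > 0` to the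
plane by `Γ₂(x) = Γ₁(x | ω₂) Γ₂(x + ω₁)`.  (At its poles the value is `0`, so that
`(Γ₂)⁻¹` is everywhere the entire function `1 / Γ₂`.) -/
def doubleGamma (x ω₁ ω₂ : ℂ) : ℂ :=
  Complex.exp (logDoubleGamma (x + dgShift x ω₁ * ω₁) ω₁ ω₂)
    * ∏ j ∈ Finset.range (dgShift x ω₁), gammaOne (x + j * ω₁) ω₂

/-- `Γ₂(x) = Γ₂(x | 2π, 2π)`. -/
def gammaTwo (x : ℂ) : ℂ := doubleGamma x (2 * Real.pi) (2 * Real.pi)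

/-- `ζ(β) = Γ₂(-iβ + 3π) Γ₂(iβ + π) / (Γ₂(-iβ + 2π) Γ₂(iβ))`. -/
def zetaFn (b : ℂ) : ℂ :=
  (gammaTwo (-Complex.I * b + 3 * Real.pi) * gammaTwo (Complex.I * b + Real.pi))
    / (gammaTwo (-Complex.I * b + 2 * Real.pi) * gammaTwo (Complex.I * b))

/-! ### Integral formula for solutions of the qKZ equation -/

/-- `V^{⊗N}` with `V = ℂ v₊ ⊕ ℂ v₋`, `v₊ = (1, 0)`, `v₋ = (0, 1)`. -/
abbrev VTensor (N : ℕ) : Type := ⨂[ℂ] _ : Fin N, (Fin 2 → ℂ)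

/-- `v_M = v_{ε₁} ⊗ ⋯ ⊗ v_{ε_N}` with `M = {i | ε_i = -}`. -/
def vM {N : ℕ} (S : Finset (Fin N)) : VTensor N :=
  PiTensorProduct.tprod ℂ (fun i => if i ∈ S then ![0, 1] else ![1, 0])

/-- The function `φ(α) = ∏_j Γ((α - β_j + πi)/(-2πi)) / Γ((α - β_j)/(-2πi))`. -/
def phi {N : ℕ} (β : Fin N → ℂ) (α : ℂ) : ℂ :=
  ∏ j, Complex.Gamma ((α - β j + Real.pi * Complex.I) / (-2 * Real.pi * Complex.I))
    / Complex.Gamma ((α - β j) / (-2 * Real.pi * Complex.I))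

/-- The function `g_M` for the subset `M = {m₁ < ⋯ < m_ℓ}`, given by its increasing
enumeration `m`. -/
def gFn {N ℓ : ℕ} (β : Fin N → ℂ) (m : Fin ℓ → Fin N) (α : Fin ℓ → ℂ) : ℂ :=
  (∏ a, (1 / (α a - β (m a)) *
      ∏ j ∈ Finset.univ.filter (fun j => j < m a),
        (α a - β j + Real.pi * Complex.I) / (α a - β j)))
    * ∏ p ∈ (Finset.univ : Finset (Fin ℓ × Fin ℓ)).filter (fun p => p.1 < p.2),
        (α p.1 - α p.2 + Real.pi * Complex.I)

/-- Antisymmetrization `Asym f = ∑_σ sgn(σ) f(α_{σ(1)}, …, α_{σ(ℓ)})`. -/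
def asym {ℓ : ℕ} (f : (Fin ℓ → ℂ) → ℂ) (α : Fin ℓ → ℂ) : ℂ :=
  ∑ σ : Equiv.Perm (Fin ℓ), ((Equiv.Perm.sign σ : ℤ) : ℂ) * f (α ∘ σ)

/-- `w_M = Asym g_M` for a subset `M` with `ℓ` elements. -/
def wM {N ℓ : ℕ} (β : Fin N → ℂ) (S : {S : Finset (Fin N) // S.card = ℓ}) :
    (Fin ℓ → ℂ) → ℂ :=
  asym (gFn β (fun a => S.1.orderEmbOfFin S.2 a))

/-- `z` lies above the curve `γ`: it can be joined to `+i∞` without crossing the curve. -/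
def LiesAbove (γ : ℝ → ℂ) (z : ℂ) : Prop :=
  ∀ᶠ y : ℝ in Filter.atTop, JoinedIn (Set.range γ)ᶜ z (y * Complex.I)

/-- `z` lies below the curve `γ`: it can be joined to `-i∞` without crossing the curve. -/
def LiesBelow (γ : ℝ → ℂ) (z : ℂ) : Prop :=
  ∀ᶠ y : ℝ in Filter.atTop, JoinedIn (Set.range γ)ᶜ z (-(y * Complex.I))

/-- `γ` parametrizes an admissible contour `C` for the rapidities `β`: a simple, piecewise
`C¹` curve going from `-∞` to `∞`, separating the points `β_j - πi + 2πik`, `k ≥ 0`, which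
lie above it, from the points `β_j - 2πik`, `k ≥ 0`, which lie below it. -/
structure IsContour {N : ℕ} (β : Fin N → ℂ) (γ : ℝ → ℂ) : Prop where
  continuous : Continuous γ
  simple : Function.Injective γ
  piecewise_C1 : ∃ S : Finset ℝ, ∃ K : ℝ, ∀ t ∉ S, ContDiffAt ℝ 1 γ t ∧ ‖deriv γ t‖ ≤ K
  from_neg_infty : ∃ a : ℂ, ∀ᶠ t : ℝ in Filter.atBot, γ t = t + a
  to_pos_infty : ∃ b : ℂ, ∀ᶠ t : ℝ in Filter.atTop, γ t = t + b
  above : ∀ (j : Fin N) (k : ℕ),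
    LiesAbove γ (β j - Real.pi * Complex.I + 2 * Real.pi * Complex.I * k)
  below : ∀ (j : Fin N) (k : ℕ), LiesBelow γ (β j - 2 * Real.pi * Complex.I * k)

/-- The deformed cycle `W = P(A₁, …, A_ℓ) / ∏_a ∏_j (1 - A_a B_j⁻¹)` as a function of the
`α_a`, where `A_a = e^{-α_a}`, `B_j = e^{-β_j}`. -/
def cycleFn {N ℓ : ℕ} (P : (Fin ℓ → ℂ) → ℂ) (β : Fin N → ℂ) (α : Fin ℓ → ℂ) : ℂ :=
  P (fun a => Complex.exp (-α a))
    / ∏ a, ∏ j, (1 - Complex.exp (-α a) * (Complex.exp (-β j))⁻¹)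

/-- The integrand of the coefficient of `v_M` in `ψ_W`, pulled back to `ℝ^ℓ` by the
parametrization `γ` of `C`. -/
def psiIntegrand {N ℓ : ℕ} (γ : ℝ → ℂ) (W : (Fin ℓ → ℂ) → ℂ) (β : Fin N → ℂ)
    (S : {S : Finset (Fin N) // S.card = ℓ}) (t : Fin ℓ → ℝ) : ℂ :=
  (∏ a, deriv γ (t a)) * ((∏ a, phi β (γ (t a)))
    * wM β S (fun a => γ (t a)) * W (fun a => γ (t a)))

/-- `ψ_W = ∑_{#M = ℓ} v_M ∫_{C^ℓ} ∏_a dα_a ∏_a φ(α_a) w_M W`. -/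
def psiFn {N ℓ : ℕ} (γ : ℝ → ℂ) (W : (Fin ℓ → ℂ) → ℂ) (β : Fin N → ℂ) : VTensor N :=
  ∑ S : {S : Finset (Fin N) // S.card = ℓ},
    (∫ t : Fin ℓ → ℝ, psiIntegrand γ W β S t) • vM S.1

/-! ### Form factors of the energy-momentum tensor -/

/-- The constant `c_N^{m,r,s}` (for even `m ≤ N`). -/
def cConst (N m r s : ℕ) : ℂ :=
  (-1) ^ ((N - m) / 2 * s + m * (m - 1) / 2)
    * (-2 * Real.pi / zetaFn (-(Real.pi * Complex.I))) ^ ((N - m) / 2)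
    * (-2 * Real.pi * Complex.I) ^ ((((m : ℤ) - N) * (2 * N + 2 * r - m)) / 4)

/-- The cycle `P_{μν}`, in the `n` variables `A₁, …, A_n` (it does not involve `A_n`):
`c_{2n}^{2,1,0} (∑ B_j⁻¹ - (-1)^ν ∑ B_j)
((-1)^{μ+n} ∏ B_j ∏_{a=1}^{n-1} A_a^{2a-1} + ∏_{a=1}^{n-1} A_a^{2a+1})`.
The indices of `Fin n` start at `0`, so that `a : Fin n` is the index `a + 1` of the formula. -/
def emCycle (n : ℕ) (μ ν : Fin 2) (B : Fin (2 * n) → ℂ) (A : Fin n → ℂ) : ℂ :=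
  cConst (2 * n) 2 1 0
    * ((∑ j, (B j)⁻¹) - (-1) ^ (ν : ℕ) * ∑ j, B j)
    * ((-1) ^ ((μ : ℕ) + n) * (∏ j, B j)
          * ∏ a ∈ Finset.univ.filter (fun a : Fin n => (a : ℕ) + 1 < n), A a ^ (2 * (a : ℕ) + 1)
        + ∏ a ∈ Finset.univ.filter (fun a : Fin n => (a : ℕ) + 1 < n), A a ^ (2 * (a : ℕ) + 3))

/-- The cycle `P_{μν}` divided by its denominator, as a function of the `α_a`. -/
def emW (n : ℕ) (μ ν : Fin 2) (β : Fin (2 * n) → ℂ) : (Fin n → ℂ) → ℂ :=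
  cycleFn (emCycle n μ ν (fun j => Complex.exp (-β j))) β

/-- The constant `C^{T_{μν}} = -M² / (32 π² ζ(-πi))`. -/
def emConst (M : ℝ) : ℂ :=
  -(M : ℂ) ^ 2 / (32 * (Real.pi : ℂ) ^ 2 * zetaFn (-(Real.pi * Complex.I)))

/-- The `2n`-particle form factor `f_{μν}(β₁, …, β_{2n})` of the energy-momentum tensor,
computed with the contour `γ`. -/
def emFormFactor (M : ℝ) (n : ℕ) (γ : ℝ → ℂ) (μ ν : Fin 2) (β : Fin (2 * n) → ℂ) :
    VTensor (2 * n) :=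
  (emConst M * Complex.exp ((n : ℂ) / 2 * ∑ j, β j)
    * ∏ p ∈ (Finset.univ : Finset (Fin (2 * n) × Fin (2 * n))).filter (fun p => p.1 < p.2),
        zetaFn (β p.1 - β p.2))
    • psiFn γ (emW n μ ν β) β

/-! ### Space-time derivatives of form factors -/

/-- Total energy `p₀ = M ∑ cosh β_j` and momentum `p₁ = M ∑ sinh β_j`. -/
def momentum {N : ℕ} (M : ℝ) (β : Fin N → ℂ) : Fin 2 → ℂ :=
  ![M * ∑ j, Complex.cosh (β j), M * ∑ j, Complex.sinh (β j)]

/-- The dependence on the space-time point `x = (x₀, x₁)` of the form factors of an operator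
`O(x)`: they are `planeWave M β x • f`, where `f` are the form factors of `O(0)`. -/
def planeWave {N : ℕ} (M : ℝ) (β : Fin N → ℂ) (x : Fin 2 → ℝ) : ℂ :=
  Complex.exp (-Complex.I * ∑ σ, (x σ : ℂ) * momentum M β σ)

/-- The partial derivative `∂_κ = ∂/∂x_κ`, at the space-time point `x`, of the form factor
`planeWave M β x • f`, where `f` does not depend on `x`. -/
def formFactorDeriv {N : ℕ} (M : ℝ) (κ : Fin 2) (x : Fin 2 → ℝ) (β : Fin N → ℂ)
    (f : VTensor N) : VTensor N :=
  deriv (fun s : ℝ => planeWave M β (Function.update x κ s)) (x κ) • f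

/-- `∂₀` and `∂₁` act on the form factors at `x` by multiplication by `-iM ∑ cosh β_j` and
`-iM ∑ sinh β_j`. -/
theorem formFactorDeriv_eq {N : ℕ} (M : ℝ) (κ : Fin 2) (x : Fin 2 → ℝ) (β : Fin N → ℂ)
    (f : VTensor N) :
    formFactorDeriv M κ x β f
      = (-Complex.I * momentum M β κ) • (planeWave M β x • f) := by
  have h : HasDerivAt (fun s : ℝ => planeWave M β (Function.update x κ s))
      (planeWave M β x * (-Complex.I * momentum M β κ)) (x κ) := by
    have h1 : HasDerivAt (fun s : ℝ => -Complex.I * ∑ σ,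
        ((Function.update x κ s σ : ℝ) : ℂ) * momentum M β σ)
        (-Complex.I * momentum M β κ) (x κ) := by
      have h2 : HasDerivAt (fun s : ℝ => (s : ℂ)) 1 (x κ) := Complex.ofRealCLM.hasDerivAt
      apply HasDerivAt.const_mul
      fin_cases κ
      · simpa [Fin.sum_univ_two, Function.update] using
          (h2.mul_const (momentum M β 0)).add_const ((x 1 : ℂ) * momentum M β 1)
      · simpa [Fin.sum_univ_two, Function.update] using
          (h2.mul_const (momentum M β 1)).const_add ((x 0 : ℂ) * momentum M β 0)
    have h3 := h1.cexp
    simpa [planeWave] using h3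
  rw [formFactorDeriv, h.deriv, smul_smul, mul_comm]

end SU2ITM

end

noncomputable section

namespace SU2ITM

/-! Put `z = (α - β_j)/(-2πi)`, so that `A B_j⁻¹ = e^{2πiz}`. For each rapidity, the factor of `φ`,
the denominator `α - β_j` from `w_S` and the denominator `1 - A B_j⁻¹` of the cycle combine, up to a
constant, into `K(z) = Γ(z - 1/2) Γ(-z) e^{-πiz}` (`gammaKernel`). By the reflection formula, `K (1
- A B_j⁻¹)` is a multiple of `Γ(z - 1/2)/Γ(z + 1)`, whose poles all lie above `C`, and `K (1 + A
B_j⁻¹)` is a multiple of `Γ(-z)/Γ(3/2 - z)`, whose poles all lie below `C`. Each is `O(|α|^{-3/2})`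
far out on its pole-free side.

The product over the `2n` rapidities thus decays like `|α|^{-3n}`, while the numerator of `w_S` has
degree at most `3n - 2` in each variable. The integrands are `O(|α|^{-2})`, and closing the contour
downwards for `∏(1 - A B_j⁻¹)` and upwards for `∏(1 + A B_j⁻¹)` gives zero in both cases. In the
difference only odd powers of `A` survive: the integrals of `A^k`, `k` odd, weighted by the
elementary symmetric functions `e_k(B⁻¹)`, sum to zero
(`IsContour.sum_esymmInv_mul_integral_eq_zero`).

This is applied to the first variable of the monomial with exponents `(1, 3, …, 2n-3, 0)`. The
numerator of `w_S` is antisymmetric, so a repeated exponent gives a zero integral. Only `k = 1`, the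
low monomial of `P_{μν}`, and `k = 2n - 1`, the high monomial up to a cyclic permutation of sign
`(-1)^n`, remain. Hence `(-1)^n (∑ B_j⁻¹)(∏ B_j) I_low + (∑ B_j) I_high = 0`
(`IsContour.cycleIntegral_relation`).

Since `p₀` and `p₁` are `M/2` times `∑ B_j⁻¹ ± ∑ B_j`, the symmetry and the conservation law are
both multiples of this one relation. The prefactors of the form factor do not depend on `μ, ν` and
play no role. -/

/-! ### Decay of the gamma quotient in a right half plane. -/

/-- The quotient `Γ(z - 1/2) / Γ(z + 1)`. -/
def gammaQuot (z : ℂ) : ℂ := Complex.Gamma (z - 1 / 2) / Complex.Gamma (z + 1)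

lemma differentiableAt_gammaQuot {z : ℂ} (hz : 1 / 2 < z.re) :
    DifferentiableAt ℂ gammaQuot z := by
  unfold gammaQuot
  have h1 : DifferentiableAt ℂ Complex.Gamma (z - 1 / 2) := by
    apply Complex.differentiableAt_Gamma
    intro m h
    have := congrArg Complex.re h
    simp at this
    have : (0 : ℝ) ≤ m := m.cast_nonneg
    linarith
  have h2 : DifferentiableAt ℂ Complex.Gamma (z + 1) := by
    apply Complex.differentiableAt_Gamma
    intro m h
    have := congrArg Complex.re h
    simp at this
    have : (0 : ℝ) ≤ m := m.cast_nonneg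
    linarith
  have h3 : Complex.Gamma (z + 1) ≠ 0 := by
    apply Complex.Gamma_ne_zero_of_re_pos
    simp
    linarith
  have e1 : DifferentiableAt ℂ (fun z : ℂ => Complex.Gamma (z - 1 / 2)) z :=
    h1.comp (f := fun z : ℂ => z - 1 / 2) z (by fun_prop)
  have e2 : DifferentiableAt ℂ (fun z : ℂ => Complex.Gamma (z + 1)) z :=
    h2.comp (f := fun z : ℂ => z + 1) z (by fun_prop)
  exact e1.div e2 h3

/-- The quotient is a Beta integral `B(z - 1/2, 3/2)` divided by `Γ(3/2)`, and the integrand is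
dominated by `x^{-1/2}`. This crude bound supplies the growth hypothesis of the Phragmén–Lindelöf
principle. -/
lemma exists_norm_gammaQuot_le_const : ∃ C : ℝ, ∀ z : ℂ, 1 ≤ z.re → ‖gammaQuot z‖ ≤ C := by
  have h32 : Complex.Gamma (3 / 2) ≠ 0 := by
    apply Complex.Gamma_ne_zero_of_re_pos
    norm_num
  refine ⟨(∫ x in (0 : ℝ)..1, x ^ (-(1 / 2) : ℝ)) / ‖Complex.Gamma (3 / 2)‖, fun z hz => ?_⟩
  have hne : Complex.Gamma (z + 1) ≠ 0 := by
    apply Complex.Gamma_ne_zero_of_re_pos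
    simp; linarith
  have hb := Complex.Gamma_mul_Gamma_eq_betaIntegral (s := z - 1 / 2) (t := 3 / 2)
    (by simp; linarith) (by norm_num)
  have hs : z - 1 / 2 + 3 / 2 = z + 1 := by ring
  rw [hs] at hb
  have hq : gammaQuot z = Complex.betaIntegral (z - 1 / 2) (3 / 2) / Complex.Gamma (3 / 2) := by
    rw [gammaQuot, div_eq_div_iff hne h32, hb, mul_comm]
  rw [hq, norm_div]
  gcongr
  unfold Complex.betaIntegral
  apply intervalIntegral.norm_integral_le_of_norm_le zero_le_one
  · refine Filter.Eventually.of_forall fun x hx => ?_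
    rw [norm_mul]
    have h1 : ‖(x : ℂ) ^ (z - 1 / 2 - 1)‖ ≤ x ^ (-(1 / 2) : ℝ) := by
      rw [Complex.norm_cpow_eq_rpow_re_of_pos hx.1]
      apply Real.rpow_le_rpow_of_exponent_ge hx.1 hx.2
      simp; linarith
    have h2 : ‖(1 - (x : ℂ)) ^ ((3 / 2 : ℂ) - 1)‖ ≤ 1 := by
      have : (1 - (x : ℂ)) = ((1 - x : ℝ) : ℂ) := by push_cast; ring
      rw [this]
      rcases eq_or_lt_of_le hx.2 with h | h
      · rw [h]
        norm_num
      · rw [Complex.norm_cpow_eq_rpow_re_of_pos (by linarith)]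
        apply Real.rpow_le_one (by linarith) (by linarith [hx.1])
        norm_num
    calc _ ≤ x ^ (-(1 / 2) : ℝ) * 1 := by
          gcongr
          exact Real.rpow_nonneg hx.1.le _
      _ = _ := mul_one _
  · exact intervalIntegral.intervalIntegrable_rpow' (by norm_num)

/-- Log-convexity of `Γ` at the midpoint of `x - 1` and `x` gives `Γ(x - 1/2)² ≤ Γ(x - 1) Γ(x)`; the
functional equation does the rest. -/
lemma gammaQuot_ofReal_sq_mul_le {x : ℝ} (hx : 2 ≤ x) : ‖gammaQuot x‖ ^ 2 * x ^ 3 ≤ 2 := by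
  have e : gammaQuot x = ((Real.Gamma (x - 1 / 2) / Real.Gamma (x + 1) : ℝ) : ℂ) := by
    unfold gammaQuot
    push_cast [← Complex.Gamma_ofReal]
    rfl
  have hp : 0 < Real.Gamma x := Real.Gamma_pos_of_pos (by linarith)
  have hp1 : 0 < Real.Gamma (x - 1) := Real.Gamma_pos_of_pos (by linarith)
  have hp2 : 0 < Real.Gamma (x - 1 / 2) := Real.Gamma_pos_of_pos (by linarith)
  have h1 : Real.Gamma (x + 1) = x * Real.Gamma x := Real.Gamma_add_one (by linarith)
  have h2 : Real.Gamma x = (x - 1) * Real.Gamma (x - 1) := by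
    have := Real.Gamma_add_one (s := x - 1) (by linarith)
    rwa [sub_add_cancel] at this
  have h3 := Real.Gamma_mul_add_mul_le_rpow_Gamma_mul_rpow_Gamma (s := x - 1) (t := x)
    (a := 1 / 2) (b := 1 / 2) (by linarith) (by linarith) (by norm_num) (by norm_num) (by norm_num)
  have h4 : (1 / 2 : ℝ) * (x - 1) + 1 / 2 * x = x - 1 / 2 := by ring
  rw [h4, ← Real.mul_rpow hp1.le hp.le, ← Real.sqrt_eq_rpow] at h3
  have h5 : Real.Gamma (x - 1 / 2) ^ 2 ≤ Real.Gamma (x - 1) * Real.Gamma x := by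
    rw [← Real.sq_sqrt (mul_pos hp1 hp).le]
    gcongr
  rw [e, Complex.norm_real, Real.norm_eq_abs, sq_abs, h1, div_pow, mul_pow, div_mul_eq_mul_div,
    div_le_iff₀ (by positivity)]
  have h6 : x * Real.Gamma (x - 1) ≤ 2 * Real.Gamma x := by
    rw [h2]
    nlinarith
  calc Real.Gamma (x - 1 / 2) ^ 2 * x ^ 3 ≤ (Real.Gamma (x - 1) * Real.Gamma x) * x ^ 3 := by gcongr
    _ = (x * Real.Gamma (x - 1)) * (Real.Gamma x * x ^ 2) := by ring
    _ ≤ (2 * Real.Gamma x) * (Real.Gamma x * x ^ 2) := by gcongr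
    _ = _ := by ring

/-- On the line `Re s = 1/2` one has `1 - s = conj s`, so the reflection formula computes the
squared modulus. -/
lemma norm_Gamma_half_add_mul_I_sq (y : ℝ) :
    ‖Complex.Gamma (1 / 2 + y * Complex.I)‖ ^ 2 = Real.pi / Real.cosh (Real.pi * y) := by
  have h := Complex.Gamma_mul_Gamma_one_sub (1 / 2 + y * Complex.I)
  have h1 : (1 : ℂ) - (1 / 2 + y * Complex.I) = starRingEnd ℂ (1 / 2 + y * Complex.I) := by
    simp [Complex.conj_ofNat]
    ring
  have h2 : Complex.sin (Real.pi * (1 / 2 + y * Complex.I)) = (Real.cosh (Real.pi * y) : ℝ) := by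
    have : (Real.pi : ℂ) * (1 / 2 + y * Complex.I)
        = (Real.pi * y : ℂ) * Complex.I + Real.pi / 2 := by ring
    rw [this, Complex.sin_add_pi_div_two, Complex.cos_mul_I]
    push_cast
    rfl
  rw [h1, Complex.Gamma_conj, Complex.mul_conj, h2, Complex.normSq_eq_norm_sq] at h
  exact_mod_cast h

lemma norm_Gamma_one_add_mul_I_sq {y : ℝ} (hy : y ≠ 0) :
    ‖Complex.Gamma (1 + y * Complex.I)‖ ^ 2 = Real.pi * y / Real.sinh (Real.pi * y) := by
  have hyI : (y : ℂ) * Complex.I ≠ 0 := by simp [hy]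
  have h := Complex.Gamma_mul_Gamma_one_sub (y * Complex.I)
  have h1 : (1 : ℂ) - y * Complex.I = starRingEnd ℂ (1 + y * Complex.I) := by
    simp
    ring
  have h2 : Complex.Gamma (1 + y * Complex.I)
      = y * Complex.I * Complex.Gamma (y * Complex.I) := by
    rw [add_comm, Complex.Gamma_add_one _ hyI]
  have h3 : Complex.sin (Real.pi * (y * Complex.I))
      = (Real.sinh (Real.pi * y) : ℝ) * Complex.I := by
    rw [← mul_assoc, Complex.sin_mul_I]
    push_cast
    rfl
  have h4 : Complex.Gamma (1 + y * Complex.I) * starRingEnd ℂ (Complex.Gamma (1 + y * Complex.I))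
      = ((Real.pi * y / Real.sinh (Real.pi * y) : ℝ) : ℂ) := by
    rw [← Complex.Gamma_conj, ← h1]
    nth_rewrite 1 [h2]
    rw [mul_assoc, h, h3]
    have : (Complex.sinh (Real.pi * y)) ≠ 0 := by
      have : Real.sinh (Real.pi * y) ≠ 0 := by
        rw [Ne, Real.sinh_eq_zero]
        simp [hy, Real.pi_ne_zero]
      exact_mod_cast this
    push_cast
    field_simp
  rw [Complex.mul_conj, Complex.normSq_eq_norm_sq] at h4
  exact_mod_cast h4

lemma sinh_le_mul_cosh {x : ℝ} (hx : 0 ≤ x) : Real.sinh x ≤ x * Real.cosh x := by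
  have h : MonotoneOn (fun x => x * Real.cosh x - Real.sinh x) (Set.Ici 0) := by
    apply monotoneOn_of_deriv_nonneg (convex_Ici 0)
    · fun_prop
    · fun_prop
    · intro y hy
      rw [interior_Ici] at hy
      have hd : HasDerivAt (fun x => x * Real.cosh x - Real.sinh x)
          (1 * Real.cosh y + y * Real.sinh y - Real.cosh y) y :=
        ((hasDerivAt_id y).mul (Real.hasDerivAt_cosh y)).sub (Real.hasDerivAt_sinh y)
      rw [hd.deriv]
      have := Real.sinh_nonneg_iff.mpr (le_of_lt hy)
      have hy' : 0 ≤ y := le_of_lt hy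
      nlinarith [mul_nonneg hy' this]
  have := h (Set.mem_Ici.mpr le_rfl) (Set.mem_Ici.mpr hx) hx
  simp at this
  linarith

/-- The two explicit moduli reduce the left side to `|1 + iy| tanh(π|y|)/|y|` for `y ≠ 0`. It is
bounded through `tanh ≤ 1` for `|y| ≥ 1` and through `tanh x ≤ x` for `|y| ≤ 1`. -/
lemma norm_gammaQuot_one_add_mul_I_sq_mul_le (y : ℝ) :
    ‖gammaQuot (1 + y * Complex.I)‖ ^ 2 * ‖1 + y * Complex.I‖ ^ 3 ≤ 8 := by
  have hne : (1 + y * Complex.I : ℂ) ≠ 0 := by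
    intro h
    simpa using congrArg Complex.re h
  have hG : Complex.Gamma (1 + y * Complex.I) ≠ 0 := by
    apply Complex.Gamma_ne_zero_of_re_pos
    simp
  have e : ‖gammaQuot (1 + y * Complex.I)‖ ^ 2 * ‖1 + y * Complex.I‖ ^ 3
      = ‖Complex.Gamma (1 / 2 + y * Complex.I)‖ ^ 2
        / ‖Complex.Gamma (1 + y * Complex.I)‖ ^ 2 * ‖1 + y * Complex.I‖ := by
    have h1 : (1 + y * Complex.I - 1 / 2 : ℂ) = 1 / 2 + y * Complex.I := by ring
    have h2 : ‖(1 + y * Complex.I : ℂ)‖ ≠ 0 := norm_ne_zero_iff.mpr hne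
    have h3 : ‖Complex.Gamma (1 + y * Complex.I)‖ ≠ 0 := norm_ne_zero_iff.mpr hG
    rw [gammaQuot, Complex.Gamma_add_one _ hne, h1, norm_div, norm_mul]
    field_simp
  rw [e, norm_Gamma_half_add_mul_I_sq]
  have hn : ‖(1 + y * Complex.I : ℂ)‖ ≤ 1 + |y| := by
    simpa using norm_add_le (1 : ℂ) (y * Complex.I)
  have hpi := Real.pi_lt_four
  have hpi0 := Real.pi_pos
  rcases eq_or_ne y 0 with rfl | hy
  · simp
    linarith
  rw [norm_Gamma_one_add_mul_I_sq hy]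
  have hsgn : Real.pi / Real.cosh (Real.pi * y) / (Real.pi * y / Real.sinh (Real.pi * y))
      = Real.sinh (Real.pi * |y|) / (Real.cosh (Real.pi * |y|) * |y|) := by
    rcases le_total 0 y with h | h
    · rw [abs_of_nonneg h]
      field_simp
    · rw [abs_of_nonpos h, mul_neg, Real.sinh_neg, Real.cosh_neg]
      field_simp
  rw [hsgn]
  have hy0 : 0 < |y| := abs_pos.mpr hy
  have hc : 0 < Real.cosh (Real.pi * |y|) := Real.cosh_pos _
  rw [div_mul_eq_mul_div, div_le_iff₀ (by positivity)]
  have hs0 : 0 ≤ Real.sinh (Real.pi * |y|) := Real.sinh_nonneg_iff.mpr (by positivity)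
  have hs1 : Real.sinh (Real.pi * |y|) ≤ Real.cosh (Real.pi * |y|) := (Real.sinh_lt_cosh _).le
  have hs2 := sinh_le_mul_cosh (x := Real.pi * |y|) (by positivity)
  rcases le_total 1 |y| with h | h
  · calc _ ≤ Real.cosh (Real.pi * |y|) * (8 * |y|) := by
          gcongr
          linarith
      _ = _ := by ring
  · calc _ ≤ (4 * |y| * Real.cosh (Real.pi * |y|)) * 2 := by
          gcongr
          · refine hs2.trans ?_
            gcongr
          · linarith
      _ = _ := by ring

/-- `Γ(z - 1/2) / Γ(z + 1) = O(|z|^{-3/2})` uniformly on `Re z ≥ 1`. -/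
lemma exists_norm_gammaQuot_le :
    ∃ C : ℝ, 0 < C ∧ ∀ z : ℂ, 1 ≤ z.re → ‖gammaQuot z‖ ≤ C * ‖z‖ ^ (-(3 / 2) : ℝ) := by
  obtain ⟨C₀, hC₀⟩ := exists_norm_gammaQuot_le_const
  -- Squaring turns the exponent `3/2` into an integer, so `f` is holomorphic without a choice of
  -- branch. Phragmén–Lindelöf on the right half plane needs the bound `8` on the imaginary axis,
  -- boundedness on the positive axis and subquadratic exponential growth.
  let f : ℂ → ℂ := fun z => gammaQuot (1 + z) ^ 2 * (1 + z) ^ 3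
  have hf : ∀ z : ℂ, 0 ≤ z.re → ‖f z‖ ≤ 8 := by
    intro z hz
    refine PhragmenLindelof.right_half_plane_of_bounded_on_real ?_ ?_ ?_ ?_ hz
    · have : DifferentiableOn ℂ f {z | -(1 / 2) < z.re} := by
        intro w hw
        have h1 : DifferentiableAt ℂ gammaQuot (1 + w) := differentiableAt_gammaQuot (by
          simp at hw ⊢; linarith)
        have h2 : DifferentiableAt ℂ (fun w => gammaQuot (1 + w)) w :=
          h1.comp (f := fun w : ℂ => 1 + w) w (by fun_prop)
        exact ((h2.pow 2).mul (by fun_prop)).differentiableWithinAt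
      apply DifferentiableOn.diffContOnCl
      apply this.mono
      have : closure {z : ℂ | 0 < z.re} = {z | 0 ≤ z.re} := Complex.closure_setOfPred_lt_re 0
      rw [this]
      intro w hw
      simp at hw ⊢
      linarith
    · refine ⟨1, by norm_num, 3, Asymptotics.IsBigO.of_bound (C₀ ^ 2) ?_⟩
      rw [Filter.eventually_inf_principal]
      refine Filter.Eventually.of_forall fun w hw => ?_
      rw [Real.norm_eq_abs, Real.abs_exp, norm_mul, norm_pow, norm_pow]
      have h1 := hC₀ (1 + w) (by simp at hw ⊢; linarith)
      have h2 : ‖1 + w‖ ≤ Real.exp ‖w‖ := by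
        have := norm_add_le 1 w
        have := Real.add_one_le_exp ‖w‖
        simp at *
        linarith
      have h3 : Real.exp (3 * ‖w‖ ^ (1 : ℝ)) = Real.exp ‖w‖ ^ 3 := by
        rw [← Real.exp_nat_mul]; simp
      rw [h3]
      gcongr
    · refine ⟨2, Filter.eventually_map.mpr ?_⟩
      filter_upwards [Filter.eventually_ge_atTop 1] with x hx
      have := gammaQuot_ofReal_sq_mul_le (x := 1 + x) (by linarith)
      simp only [f, norm_mul, norm_pow]
      have e : ((1 + x : ℝ) : ℂ) = 1 + x := by push_cast; rfl
      rw [e] at this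
      rw [← e, Complex.norm_real, Real.norm_eq_abs, abs_of_nonneg (by linarith), e]
      exact this
    · intro y
      simp only [f, norm_mul, norm_pow]
      exact norm_gammaQuot_one_add_mul_I_sq_mul_le y
  -- Any constant whose square is at least `8` serves.
  refine ⟨3, by norm_num, fun z hz => ?_⟩
  have h := hf (z - 1) (by simpa using hz)
  simp only [f, add_sub_cancel, norm_mul, norm_pow] at h
  have hz0 : 0 < ‖z‖ := lt_of_lt_of_le (by linarith) (Complex.re_le_norm z)
  have e : (‖z‖ ^ (-(3 / 2) : ℝ)) ^ 2 = (‖z‖ ^ 3)⁻¹ := by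
    rw [← Real.rpow_natCast, ← Real.rpow_mul hz0.le, ← Real.rpow_natCast, ← Real.rpow_neg hz0.le]
    norm_num
  refine (sq_le_sq₀ (norm_nonneg _) (by positivity)).mp ?_
  rw [mul_pow, e, ← div_eq_mul_inv, le_div_iff₀ (by positivity)]
  linarith

/-! ### Tame curves and integrability along them. -/

/-- A piecewise differentiable curve with bounded speed which stays at bounded distance from the
parametrization of the real line. -/
structure TameCurve (γ : ℝ → ℂ) : Prop where
  continuous : Continuous γ
  bounded : ∃ D : ℝ, 0 ≤ D ∧ ∀ t : ℝ, ‖γ t - t‖ ≤ D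
  smooth : ∃ S : Finset ℝ, ∃ K : ℝ, ∀ t ∉ S, DifferentiableAt ℝ γ t ∧ ‖deriv γ t‖ ≤ K

lemma IsContour.tameCurve {N : ℕ} {β : Fin N → ℂ} {γ : ℝ → ℂ} (h : IsContour β γ) :
    TameCurve γ := by
  refine ⟨h.continuous, ?_, ?_⟩
  · obtain ⟨a, ha⟩ := h.from_neg_infty
    obtain ⟨b, hb⟩ := h.to_pos_infty
    obtain ⟨s, hs⟩ := Filter.eventually_atBot.mp ha
    obtain ⟨u, hu⟩ := Filter.eventually_atTop.mp hb
    have hc : Continuous fun t : ℝ => γ t - t := h.continuous.sub Complex.continuous_ofReal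
    obtain ⟨C, hC⟩ := (isCompact_Icc (a := s) (b := u)).exists_bound_of_continuousOn hc.continuousOn
    refine ⟨max ‖a‖ (max ‖b‖ C), (norm_nonneg a).trans (le_max_left _ _), fun t => ?_⟩
    by_cases h1 : t ≤ s
    · rw [hs t h1]
      simp
    by_cases h2 : u ≤ t
    · rw [hu t h2]
      simp
    exact (hC t ⟨(not_le.mp h1).le, (not_le.mp h2).le⟩).trans
      ((le_max_right _ _).trans (le_max_right _ _))
  · obtain ⟨S, K, hK⟩ := h.piecewise_C1
    exact ⟨S, K, fun t ht => ⟨(hK t ht).1.differentiableAt (by norm_num), (hK t ht).2⟩⟩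

lemma deriv_neg_comp_neg (γ : ℝ → ℂ) (t : ℝ) : deriv (fun s => -γ (-s)) t = deriv γ (-t) := by
  rw [deriv.fun_neg, deriv_comp_neg, neg_neg]

/-- The half-turn `α ↦ -α`, with time reversed, exchanges the two sides of the curve, so that only
contours closed upwards have to be treated. -/
lemma TameCurve.neg {γ : ℝ → ℂ} (h : TameCurve γ) : TameCurve fun t => -γ (-t) := by
  refine ⟨(h.continuous.comp continuous_neg).neg, ?_, ?_⟩
  · obtain ⟨D, hD0, hD⟩ := h.bounded
    refine ⟨D, hD0, fun t => ?_⟩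
    have := hD (-t)
    rw [← norm_neg]
    have e : -(-γ (-t) - (t : ℂ)) = γ (-t) - ((-t : ℝ) : ℂ) := by
      push_cast
      ring
    rwa [e]
  · obtain ⟨S, K, hK⟩ := h.smooth
    classical
    refine ⟨S.image (fun x => -x), K, fun t ht => ?_⟩
    have ht' : -t ∉ S := fun hm => ht (Finset.mem_image.mpr ⟨-t, hm, neg_neg t⟩)
    obtain ⟨h1, h2⟩ := hK (-t) ht'
    refine ⟨?_, by rwa [deriv_neg_comp_neg]⟩
    exact (DifferentiableAt.comp (f := fun s : ℝ => -s) t h1 (by fun_prop)).neg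

lemma TameCurve.exists_one_add_abs_le {γ : ℝ → ℂ} (h : TameCurve γ) :
    ∃ c : ℝ, 0 < c ∧ ∀ t, 1 + |t| ≤ c * (1 + ‖γ t‖) ∧ 1 + ‖γ t‖ ≤ c * (1 + |t|) := by
  obtain ⟨D, hD0, hD⟩ := h.bounded
  refine ⟨1 + D, by linarith, fun t => ?_⟩
  have h1 := hD t
  have h2 : |t| ≤ ‖γ t‖ + ‖γ t - t‖ := by
    have := norm_sub_le (γ t) (γ t - t)
    simpa using this
  have h3 : ‖γ t‖ ≤ |t| + ‖γ t - t‖ := by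
    have := norm_add_le (t : ℂ) (γ t - t)
    simpa using this
  constructor
  · nlinarith [norm_nonneg (γ t), mul_nonneg hD0 (norm_nonneg (γ t))]
  · nlinarith [abs_nonneg t, mul_nonneg hD0 (abs_nonneg t)]

/-- The curve is proper, as `‖γ t‖` grows like `|t|`. Closedness makes every point off the curve
keep a positive distance from it. -/
lemma TameCurve.isClosed_range {γ : ℝ → ℂ} (h : TameCurve γ) : IsClosed (Set.range γ) := by
  obtain ⟨c, hc, hγ⟩ := h.exists_one_add_abs_le
  have : Filter.Tendsto γ (Filter.cocompact ℝ) (Filter.cocompact ℂ) := by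
    apply tendsto_cocompact_of_tendsto_dist_comp_atTop (0 : ℂ)
    have h1 : Filter.Tendsto (fun t : ℝ => ‖t‖ / c - 1) (Filter.cocompact ℝ) Filter.atTop :=
      Filter.tendsto_atTop_add_const_right _ _
        ((tendsto_norm_cocompact_atTop).atTop_div_const hc)
    refine Filter.tendsto_atTop_mono (fun t => ?_) h1
    have := (hγ t).1
    rw [dist_zero_right, Real.norm_eq_abs, sub_le_iff_le_add, div_le_iff₀ hc]
    linarith
  exact ((isProperMap_iff_tendsto_cocompact).mpr ⟨h.continuous, this⟩).isClosedMap.isClosed_range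

lemma integrable_one_add_abs_rpow_neg_two :
    MeasureTheory.Integrable fun t : ℝ => (1 + |t|) ^ (-2 : ℝ) := by
  have := integrable_one_add_norm (E := ℝ) (μ := MeasureTheory.volume) (r := 2) (by simp)
  simpa using this

lemma TameCurve.ae_norm_deriv_le {γ : ℝ → ℂ} (h : TameCurve γ) :
    ∃ K : ℝ, 0 ≤ K ∧ ∀ᵐ t : ℝ, ‖deriv γ t‖ ≤ K := by
  obtain ⟨S, K, hK⟩ := h.smooth
  refine ⟨max K 0, le_max_right _ _, ?_⟩
  have : (S : Set ℝ)ᶜ ∈ MeasureTheory.ae (MeasureTheory.volume : MeasureTheory.Measure ℝ) :=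
    MeasureTheory.compl_mem_ae_iff.mpr (S.countable_toSet.measure_zero _)
  filter_upwards [this] with t ht
  exact (hK t ht).2.trans (le_max_left _ _)

lemma TameCurve.integrable {γ : ℝ → ℂ} (h : TameCurve γ) {f : ℝ → ℂ} (hf : Continuous f)
    {C : ℝ} (hC : ∀ t, ‖f t‖ ≤ C * (1 + |t|) ^ (-2 : ℝ)) :
    MeasureTheory.Integrable fun t => deriv γ t * f t := by
  obtain ⟨K, hK0, hK⟩ := h.ae_norm_deriv_le
  refine (integrable_one_add_abs_rpow_neg_two.const_mul (K * C)).mono'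
    ((measurable_deriv γ).aestronglyMeasurable.mul hf.aestronglyMeasurable) ?_
  filter_upwards [hK] with t ht
  rw [norm_mul, mul_assoc]
  exact mul_le_mul ht (hC t) (norm_nonneg _) hK0

lemma TameCurve.norm_comp_le {γ : ℝ → ℂ} (h : TameCurve γ) {U : Set ℂ} (hU : ∀ t, γ t ∈ U)
    {H : ℂ → ℂ} {C : ℝ} (hC0 : 0 ≤ C) (hC : ∀ z ∈ U, ‖H z‖ ≤ C * (1 + ‖z‖) ^ (-2 : ℝ)) :
    ∃ C', ∀ t, ‖H (γ t)‖ ≤ C' * (1 + |t|) ^ (-2 : ℝ) := by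
  obtain ⟨c, hc, hγ⟩ := h.exists_one_add_abs_le
  refine ⟨C * c ^ (2 : ℝ), fun t => (hC _ (hU t)).trans ?_⟩
  have h0 : 0 < 1 + ‖γ t‖ := by positivity
  have h1 : 0 < 1 + |t| := by positivity
  rw [mul_assoc]
  gcongr
  rw [Real.rpow_neg h0.le, Real.rpow_neg h1.le, ← div_eq_mul_inv, inv_le_comm₀ (by positivity)
    (by positivity), inv_div, div_le_iff₀ (by positivity), ← Real.mul_rpow h0.le hc.le]
  apply Real.rpow_le_rpow h1.le _ (by norm_num)
  linarith [(hγ t).1]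

/-! ### Cauchy's theorem along a curve, with poles below it. -/

lemma convex_lt_im (L : ℝ) : Convex ℝ {z : ℂ | L < z.im} := convex_halfSpace_im_gt L

lemma isOpen_lt_im (L : ℝ) : IsOpen {z : ℂ | L < z.im} :=
  isOpen_lt continuous_const Complex.continuous_im

lemma exists_primitive {L : ℝ} {H : ℂ → ℂ} (hH : DifferentiableOn ℂ H {z | L < z.im}) :
    ∃ G : ℂ → ℂ, ∀ z, L < z.im → HasDerivAt G (H z) z := by
  obtain ⟨G, hG⟩ := (convex_lt_im L).exists_forall_hasDerivWithinAt hH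
  exact ⟨G, fun z hz => (hG z hz).hasDerivAt ((isOpen_lt_im L).mem_nhds hz)⟩

/-- A primitive of a function which decays quadratically on a half plane takes nearly the same
values at far away points on both sides. -/
lemma norm_primitive_sub_le {L : ℝ} {H G : ℂ → ℂ} (hG : ∀ z, L < z.im → HasDerivAt G (H z) z)
    {C : ℝ} (hC0 : 0 ≤ C) (hC : ∀ z, L < z.im → ‖H z‖ ≤ C * (1 + ‖z‖) ^ (-2 : ℝ))
    {T : ℝ} (hT : 0 < T) {u v : ℂ} (hu : L < u.im) (hv : L < v.im)
    (hu0 : u.re ≤ -T) (hv0 : T ≤ v.re) {w : ℝ} (hwT : T ≤ w) (hu1 : u.im ≤ w)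
    (hv1 : v.im ≤ w) (hu2 : w - 4 * T ≤ u.im) (hv2 : w - 4 * T ≤ v.im) (hu3 : -(4 * T) ≤ u.re)
    (hv3 : v.re ≤ 4 * T) : ‖G v - G u‖ ≤ 16 * C / T := by
  have key : ∀ (s : Set ℂ) (x y : ℂ), Convex ℝ s → (∀ z ∈ s, L < z.im ∧ T ≤ ‖z‖) → x ∈ s → y ∈ s →
      ‖G y - G x‖ ≤ C / T ^ 2 * ‖y - x‖ := by
    intro s x y hs hz hx hy
    refine Convex.norm_image_sub_le_of_norm_hasDerivWithin_le (f' := H)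
      (fun z h => (hG z (hz z h).1).hasDerivWithinAt) (fun z h => ?_) hs hx hy
    refine (hC z (hz z h).1).trans ?_
    rw [div_eq_mul_inv]
    gcongr
    rw [Real.rpow_neg (by positivity)]
    have h1 := (hz z h).2
    have h2 : T ^ 2 ≤ (1 + ‖z‖) ^ (2 : ℝ) := by
      rw [Real.rpow_two]
      gcongr
      linarith
    gcongr
  -- The endpoints are joined along three sides of a rectangle with upper corners `p` and `q`. These
  -- sides stay at distance at least `T` from the origin and have length `O(T)`, and the derivative
  -- is `O(T⁻²)` there.
  let p : ℂ := ⟨u.re, w⟩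
  let q : ℂ := ⟨v.re, w⟩
  have h1 : ‖G p - G u‖ ≤ C / T ^ 2 * (4 * T) := by
    have := key ({z | L < z.im} ∩ {z | z.re ≤ -T}) u p
      ((convex_lt_im L).inter (convex_halfSpace_re_le _))
      (fun z h => ⟨h.1, by
        have := Complex.abs_re_le_norm z
        have h2 : z.re ≤ -T := h.2
        have := neg_abs_le z.re
        linarith⟩) ⟨hu, hu0⟩ ⟨lt_of_lt_of_le hu hu1, hu0⟩
    refine this.trans ?_
    gcongr
    have : p - u = ((w - u.im : ℝ) : ℂ) * Complex.I := by
      apply Complex.ext <;> simp [p]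
    rw [this, norm_mul, Complex.norm_I, mul_one, Complex.norm_real, Real.norm_eq_abs, abs_le]
    constructor <;> linarith
  have h2 : ‖G v - G q‖ ≤ C / T ^ 2 * (4 * T) := by
    have := key ({z | L < z.im} ∩ {z | T ≤ z.re}) q v
      ((convex_lt_im L).inter (convex_halfSpace_re_ge _))
      (fun z h => ⟨h.1, by
        have := Complex.re_le_norm z
        have h2 : T ≤ z.re := h.2
        linarith⟩) ⟨lt_of_lt_of_le hv hv1, hv0⟩ ⟨hv, hv0⟩
    refine this.trans ?_
    gcongr
    have : v - q = ((v.im - w : ℝ) : ℂ) * Complex.I := by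
      apply Complex.ext <;> simp [q]
    rw [this, norm_mul, Complex.norm_I, mul_one, Complex.norm_real, Real.norm_eq_abs, abs_le]
    constructor <;> linarith
  have h3 : ‖G q - G p‖ ≤ C / T ^ 2 * (8 * T) := by
    have := key ({z | L < z.im} ∩ {z | T ≤ z.im}) p q
      ((convex_lt_im L).inter (convex_halfSpace_im_ge _))
      (fun z h => ⟨h.1, by
        have := Complex.abs_im_le_norm z
        have h2 : T ≤ z.im := h.2
        have := le_abs_self z.im
        linarith⟩) ⟨lt_of_lt_of_le hu hu1, hwT⟩ ⟨lt_of_lt_of_le hu hu1, hwT⟩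
    refine this.trans ?_
    gcongr
    have : q - p = ((v.re - u.re : ℝ) : ℂ) := by
      apply Complex.ext <;> simp [q, p]
    rw [this, Complex.norm_real, Real.norm_eq_abs, abs_le]
    constructor <;> linarith
  have e : G v - G u = (G v - G q) + (G q - G p) + (G p - G u) := by ring
  have h4 : C / T ^ 2 * (4 * T) + C / T ^ 2 * (8 * T) + C / T ^ 2 * (4 * T) = 16 * C / T := by
    field_simp
    ring
  rw [e]
  refine (norm_add₃_le).trans ?_
  linarith

/-- Cauchy's theorem for functions holomorphic and decaying quadratically on a half plane. -/
lemma TameCurve.integral_eq_zero {γ : ℝ → ℂ} (h : TameCurve γ) {L : ℝ} (hL : ∀ t, L < (γ t).im)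
    {H : ℂ → ℂ} (hH : DifferentiableOn ℂ H {z | L < z.im}) {C : ℝ} (hC0 : 0 ≤ C)
    (hC : ∀ z, L < z.im → ‖H z‖ ≤ C * (1 + ‖z‖) ^ (-2 : ℝ)) :
    ∫ t, deriv γ t * H (γ t) = 0 := by
  obtain ⟨G, hG⟩ := exists_primitive hH
  obtain ⟨C', hC'⟩ := h.norm_comp_le hL hC0 hC
  have hHc : Continuous fun t => H (γ t) := hH.continuousOn.comp_continuous h.continuous hL
  have hint := h.integrable hHc hC'
  obtain ⟨S, K, hK⟩ := h.smooth
  have hftc : ∀ T : ℝ, ∫ t in (-T)..T, deriv γ t * H (γ t) = G (γ T) - G (γ (-T)) := by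
    intro T
    refine MeasureTheory.integral_eq_of_hasDerivAt_off_countable (fun t => G (γ t)) _
      S.countable_toSet ?_ ?_ hint.intervalIntegrable
    · apply Continuous.continuousOn
      rw [continuous_iff_continuousAt]
      exact fun t => (hG _ (hL t)).continuousAt.comp h.continuous.continuousAt
    · intro t ht
      have h1 := (hK t ht.2).1.hasDerivAt
      rw [mul_comm]
      exact (hG _ (hL t)).comp t h1
  have hlim := MeasureTheory.intervalIntegral_tendsto_integral hint
    Filter.tendsto_neg_atTop_atBot Filter.tendsto_id
  refine tendsto_nhds_unique hlim ?_
  obtain ⟨D, hD0, hD⟩ := h.bounded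
  have hz : Filter.Tendsto (fun T : ℝ => 16 * C / (T / 2)) Filter.atTop (nhds 0) :=
    (Filter.tendsto_id.atTop_div_const (by norm_num)).const_div_atTop _
  refine squeeze_zero_norm' ?_ hz
  -- For such `T` the endpoints `γ (±T)` have real parts of modulus between `T/2` and `2T` and
  -- imaginary parts of modulus at most `T/2`, so the rectangle estimate applies at scale `T/2`.
  filter_upwards [Filter.eventually_ge_atTop (2 * D + 1)] with T hT
  simp only [id]
  rw [hftc]
  have h1 := hD T
  have h2 := hD (-T)
  have h1r := (abs_le.mp ((Complex.abs_re_le_norm _).trans h1))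
  have h1i := (abs_le.mp ((Complex.abs_im_le_norm _).trans h1))
  have h2r := (abs_le.mp ((Complex.abs_re_le_norm _).trans h2))
  have h2i := (abs_le.mp ((Complex.abs_im_le_norm _).trans h2))
  simp at h1r h1i h2r h2i
  apply norm_primitive_sub_le hG hC0 hC (by linarith) (hL _) (hL _) (w := T / 2) <;> linarith

/-- The Cauchy transform of a density on a curve is holomorphic off the curve. -/
lemma differentiableAt_cauchyTransform {γ : ℝ → ℂ} (hγ : Continuous γ)
    (hcl : IsClosed (Set.range γ)) {f : ℝ → ℂ} (hf : MeasureTheory.Integrable f) {p : ℂ}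
    (hp : p ∉ Set.range γ) :
    DifferentiableAt ℂ (fun q => ∫ t, f t / (γ t - q)) p := by
  obtain ⟨ε, hε, hball⟩ := Metric.isOpen_iff.mp hcl.isOpen_compl p hp
  have hd : ∀ q ∈ Metric.ball p (ε / 2), ∀ t, ε / 2 ≤ ‖γ t - q‖ := by
    intro q hq t
    have h1 : ε ≤ dist (γ t) p := by
      by_contra hlt
      exact hball (Metric.mem_ball.mpr (not_le.mp hlt)) ⟨t, rfl⟩
    have h2 := dist_triangle (γ t) q p
    rw [Metric.mem_ball] at hq
    rw [← dist_eq_norm]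
    linarith
  have hne : ∀ q ∈ Metric.ball p (ε / 2), ∀ t, γ t - q ≠ 0 := fun q hq t h0 => by
    have := hd q hq t
    rw [h0, norm_zero] at this
    linarith
  have hcont : ∀ q ∈ Metric.ball p (ε / 2), Continuous fun t => (γ t - q)⁻¹ := fun q hq =>
    (hγ.sub continuous_const).inv₀ (hne q hq)
  have hpm : p ∈ Metric.ball p (ε / 2) := Metric.mem_ball_self (by linarith)
  have hmeas : ∀ q ∈ Metric.ball p (ε / 2),
      MeasureTheory.AEStronglyMeasurable (fun t => f t / (γ t - q)) := fun q hq => by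
    simp only [div_eq_mul_inv]
    exact hf.aestronglyMeasurable.mul (hcont q hq).aestronglyMeasurable
  refine (hasDerivAt_integral_of_dominated_loc_of_deriv_le
    (F' := fun q t => f t / (γ t - q) ^ 2) (bound := fun t => ‖f t‖ * ((ε / 2) ^ 2)⁻¹)
    (Metric.ball_mem_nhds p (by linarith : 0 < ε / 2)) ?_ ?_ ?_ ?_ ?_ ?_).2.differentiableAt
  · filter_upwards [Metric.ball_mem_nhds p (by linarith : 0 < ε / 2)] with q hq using hmeas q hq
  · refine (hf.norm.mul_const (ε / 2)⁻¹).mono' (hmeas p hpm) (Filter.Eventually.of_forall fun t => ?_)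
    rw [norm_div, div_eq_mul_inv]
    have := hd p hpm t
    gcongr
  · simp only [div_eq_mul_inv, ← inv_pow]
    exact hf.aestronglyMeasurable.mul ((hcont p hpm).pow 2).aestronglyMeasurable
  · refine Filter.Eventually.of_forall fun t q hq => ?_
    rw [norm_div, div_eq_mul_inv, norm_pow]
    have := hd q hq t
    gcongr
  · exact hf.norm.mul_const _
  · refine Filter.Eventually.of_forall fun t q hq => ?_
    have h1 : HasDerivAt (fun q => γ t - q) (-1) q := by
      simpa using (hasDerivAt_id q).const_sub (γ t)
    have h2 := (h1.inv (hne q hq t)).const_mul (f t)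
    rw [neg_neg, ← div_eq_mul_one_div] at h2
    exact h2

lemma exists_norm_div_sub_le {γ : ℝ → ℂ} (hcl : IsClosed (Set.range γ)) {p : ℂ}
    (hp : p ∉ Set.range γ) : ∃ C : ℝ, ∀ t, ‖(γ t - p)⁻¹‖ ≤ C := by
  obtain ⟨ε, hε, hball⟩ := Metric.isOpen_iff.mp hcl.isOpen_compl p hp
  refine ⟨ε⁻¹, fun t => ?_⟩
  rw [norm_inv]
  gcongr
  by_contra hlt
  exact hball (Metric.mem_ball.mpr (by rw [dist_eq_norm]; exact not_le.mp hlt)) ⟨t, rfl⟩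

lemma LiesBelow.notMem {γ : ℝ → ℂ} {p : ℂ} (h : LiesBelow γ p) : p ∉ Set.range γ := by
  obtain ⟨y, hy⟩ := h.exists
  exact hy.source_mem

lemma LiesAbove.notMem {γ : ℝ → ℂ} {p : ℂ} (h : LiesAbove γ p) : p ∉ Set.range γ := by
  obtain ⟨y, hy⟩ := h.exists
  exact hy.source_mem

lemma LiesAbove.neg {γ : ℝ → ℂ} {p : ℂ} (h : LiesAbove γ p) :
    LiesBelow (fun t => -γ (-t)) (-p) := by
  filter_upwards [h] with y hy
  refine (hy.map continuous_neg).mono ?_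
  rintro _ ⟨z, hz, rfl⟩ ⟨t, ht⟩
  exact hz ⟨-t, neg_injective ht⟩

/-- Each factor equals `1 + (p - p₀)/(γ t - p)`, which is bounded because `p` has positive distance
from the curve. -/
lemma TameCurve.integrable_mul_prod {γ : ℝ → ℂ} (h : TameCurve γ) {f : ℝ → ℂ}
    (hf : MeasureTheory.Integrable f) (p₀ : ℂ) {s : List ℂ} (hs : ∀ p ∈ s, LiesBelow γ p) :
    MeasureTheory.Integrable fun t =>
      f t * (s.map fun p => (γ t - p₀) / (γ t - p)).prod := by
  induction s with
  | nil => simpa using hf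
  | cons p s ih =>
    have hp := (hs p (by simp)).notMem
    obtain ⟨C, hC⟩ := exists_norm_div_sub_le h.isClosed_range hp
    have h1 := ih fun q hq => hs q (by simp [hq])
    have hne : ∀ t, γ t - p ≠ 0 := fun t h0 => hp ⟨t, sub_eq_zero.mp h0⟩
    have hc : Continuous fun t => (γ t - p₀) / (γ t - p) :=
      (h.continuous.sub continuous_const).div (h.continuous.sub continuous_const) hne
    have h2 : MeasureTheory.Integrable fun t => ((γ t - p₀) / (γ t - p)) *
        (f t * (s.map fun p => (γ t - p₀) / (γ t - p)).prod) := by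
      refine h1.bdd_mul (c := 1 + ‖p - p₀‖ * C) hc.aestronglyMeasurable
        (Filter.Eventually.of_forall fun t => ?_)
      have : (γ t - p₀) / (γ t - p) = 1 + (p - p₀) * (γ t - p)⁻¹ := by
        have := hne t
        field_simp
        ring
      rw [this]
      refine (norm_add_le _ _).trans ?_
      rw [norm_one, norm_mul]
      gcongr
      exact hC t
    refine h2.congr (Filter.Eventually.of_forall fun t => ?_)
    simp only [List.map_cons, List.prod_cons]
    ring

/-- Cauchy's theorem: the integral along a curve vanishes if all poles lie below the curve and
the integrand decays quadratically in the upper half plane. -/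
lemma TameCurve.integral_eq_zero_of_liesBelow {γ : ℝ → ℂ} (h : TameCurve γ) {L : ℝ}
    (hL : ∀ t, L < (γ t).im) (p₀ : ℂ) {s : List ℂ} (hs : ∀ p ∈ s, LiesBelow γ p)
    {H : ℂ → ℂ} (hH : DifferentiableOn ℂ H {z | L < z.im}) {C : ℝ} (hC0 : 0 ≤ C)
    (hC : ∀ z, L < z.im → ‖H z‖ ≤ C * (1 + ‖z‖) ^ (-2 : ℝ)) :
    ∫ t, deriv γ t * H (γ t) * (s.map fun p => (γ t - p₀) / (γ t - p)).prod = 0 := by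
  induction s generalizing H C with
  | nil => simpa using h.integral_eq_zero hL hH hC0 hC
  | cons p s ih =>
    have hs' : ∀ q ∈ s, LiesBelow γ q := fun q hq => hs q (by simp [hq])
    obtain ⟨C', hC'⟩ := h.norm_comp_le hL hC0 hC
    have hHc : Continuous fun t => H (γ t) := hH.continuousOn.comp_continuous h.continuous hL
    let f : ℝ → ℂ := fun t => deriv γ t * H (γ t) * (s.map fun p => (γ t - p₀) / (γ t - p)).prod
    have hf : MeasureTheory.Integrable f := h.integrable_mul_prod (h.integrable hHc hC') p₀ hs'
    have hf0 : ∫ t, f t = 0 := ih hs' hH hC0 hC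
    -- The new pole is made a variable `q`. Since `(γ t - p₀)/(γ t - q) = 1 + (q - p₀)/(γ t - q)`
    -- and `∫ f = 0` by induction, `K q` is the integral with the pole at `q`. No winding number is
    -- needed: `K` is holomorphic off the curve, and the pole is moved along the path given by
    -- `LiesBelow`.
    let K : ℂ → ℂ := fun q => (q - p₀) * ∫ t, f t / (γ t - q)
    have hKd : DifferentiableOn ℂ K (Set.range γ)ᶜ := fun q hq =>
      ((differentiableAt_id.sub_const p₀).mul
        (differentiableAt_cauchyTransform h.continuous h.isClosed_range hf hq)).differentiableWithinAt
    have hint : ∀ q ∉ Set.range γ, MeasureTheory.Integrable fun t => f t / (γ t - q) := by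
      intro q hq
      obtain ⟨C₁, hC₁⟩ := exists_norm_div_sub_le h.isClosed_range hq
      have hc : Continuous fun t => (γ t - q)⁻¹ :=
        (h.continuous.sub continuous_const).inv₀ fun t h0 => hq ⟨t, sub_eq_zero.mp h0⟩
      have := hf.bdd_mul (c := C₁) hc.aestronglyMeasurable (Filter.Eventually.of_forall hC₁)
      refine this.congr (Filter.Eventually.of_forall fun t => ?_)
      simp only
      rw [div_eq_mul_inv, mul_comm]
    have hKeq : ∀ q ∉ Set.range γ, ∫ t, f t * ((γ t - p₀) / (γ t - q)) = K q := by
      intro q hq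
      have e : ∀ t, f t * ((γ t - p₀) / (γ t - q)) = f t + (q - p₀) * (f t / (γ t - q)) := by
        intro t
        have : γ t - q ≠ 0 := fun h0 => hq ⟨t, sub_eq_zero.mp h0⟩
        field_simp
        ring
      simp only [e]
      rw [MeasureTheory.integral_add hf ((hint q hq).const_mul _), hf0, zero_add,
        MeasureTheory.integral_const_mul]
    -- A pole below the half plane is no obstruction: its factor is holomorphic and bounded there
    -- and is absorbed into `H`. This is why the induction generalizes over `H` and `C`.
    have hlow : ∀ q : ℂ, q.im < L → K q = 0 := by
      intro q hq
      have hqr : q ∉ Set.range γ := by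
        rintro ⟨t, rfl⟩
        exact absurd (hL t) (not_lt.mpr hq.le)
      rw [← hKeq q hqr]
      have hne : ∀ z : ℂ, L < z.im → z - q ≠ 0 := by
        intro z hz h0
        rw [sub_eq_zero.mp h0] at hz
        linarith
      have h1 : DifferentiableOn ℂ (fun z => H z * ((z - p₀) / (z - q))) {z | L < z.im} :=
        hH.mul (DifferentiableOn.div (by fun_prop) (by fun_prop) hne)
      have h2 := ih (H := fun z => H z * ((z - p₀) / (z - q)))
        (C := C * (1 + ‖q - p₀‖ * (L - q.im)⁻¹)) hs' h1 (by
          have : 0 < L - q.im := by linarith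
          positivity) (fun z hz => by
          have hz0 := hne z hz
          have e : (z - p₀) / (z - q) = 1 + (q - p₀) * (z - q)⁻¹ := by
            field_simp
            ring
          have hpos : 0 < L - q.im := by linarith
          have hle : L - q.im ≤ ‖z - q‖ := by
            have := Complex.abs_im_le_norm (z - q)
            have := le_abs_self (z - q).im
            simp at *
            linarith
          rw [norm_mul, e]
          calc _ ≤ (C * (1 + ‖z‖) ^ (-2 : ℝ)) * (1 + ‖q - p₀‖ * (L - q.im)⁻¹) := by
                gcongr
                · exact hC z hz
                · refine (norm_add_le _ _).trans ?_
                  rw [norm_one, norm_mul, norm_inv]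
                  gcongr
            _ = _ := by ring)
      rw [← h2]
      congr 1
      ext t
      simp only [f]
      ring
    have hp := hs p (by simp)
    -- Identity theorem on the path from `p` to a point `-iy` with `-y < L`, near which `K`
    -- vanishes.
    have hKp : K p = 0 := by
      obtain ⟨y, hy, hyL⟩ := (hp.and (Filter.eventually_gt_atTop (-L))).exists
      let U := Set.range hy.somePath
      have hU : U ⊆ (Set.range γ)ᶜ := by
        rintro _ ⟨x, rfl⟩
        exact hy.somePath_mem x
      have hpre : IsPreconnected U := isPreconnected_range hy.somePath.continuous
      have hKa : AnalyticOnNhd ℂ K U :=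
        (hKd.analyticOnNhd h.isClosed_range.isOpen_compl).mono hU
      have hz₀ : (-(y * Complex.I) : ℂ) ∈ U := ⟨1, hy.somePath.target⟩
      have hev : K =ᶠ[nhds (-(y * Complex.I) : ℂ)] 0 := by
        have : {z : ℂ | z.im < L} ∈ nhds (-(y * Complex.I) : ℂ) :=
          (isOpen_lt Complex.continuous_im continuous_const).mem_nhds (by
            change (-(y * Complex.I) : ℂ).im < L
            simp
            linarith)
        filter_upwards [this] with z hz using hlow z hz
      exact hKa.eqOn_zero_of_preconnected_of_eventuallyEq_zero hpre hz₀ hev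
        ⟨0, hy.somePath.source⟩
    rw [← hKp, ← hKeq p hp.notMem]
    congr 1
    ext t
    simp only [f, List.map_cons, List.prod_cons]
    ring

lemma TameCurve.integral_eq_zero_of_liesBelow_finset {γ : ℝ → ℂ} (h : TameCurve γ) {L : ℝ}
    (hL : ∀ t, L < (γ t).im) (p₀ : ℂ) {ι : Type*} {s : Finset ι} {p : ι → ℂ}
    (hs : ∀ i ∈ s, LiesBelow γ (p i)) {H : ℂ → ℂ} (hH : DifferentiableOn ℂ H {z | L < z.im})
    {C : ℝ} (hC0 : 0 ≤ C) (hC : ∀ z, L < z.im → ‖H z‖ ≤ C * (1 + ‖z‖) ^ (-2 : ℝ)) :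
    ∫ t, deriv γ t * H (γ t) * ∏ i ∈ s, (γ t - p₀) / (γ t - p i) = 0 := by
  have := h.integral_eq_zero_of_liesBelow hL p₀ (s := s.toList.map p) (by simpa using hs) hH hC0 hC
  rw [← this]
  congr 1
  ext t
  rw [List.map_map, ← Finset.prod_map_toList]
  rfl

/-! ### Vanishing of the integrals whose poles lie on one side of the contour. -/

/-- The argument `(α - b) / (-2πi)` of the gamma functions in `phi`. -/
def gammaArg (b α : ℂ) : ℂ := (α - b) / (-2 * Real.pi * Complex.I)

lemma neg_two_pi_I_ne_zero : (-2 * Real.pi * Complex.I : ℂ) ≠ 0 := by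
  simp [Real.pi_ne_zero]

lemma gammaArg_eq_iff {b α w : ℂ} : gammaArg b α = w ↔ α = b - 2 * Real.pi * Complex.I * w := by
  rw [gammaArg, div_eq_iff neg_two_pi_I_ne_zero]
  constructor
  · intro h
    linear_combination h
  · intro h
    linear_combination h

lemma differentiable_gammaArg (b : ℂ) : Differentiable ℂ (gammaArg b) := by
  unfold gammaArg
  fun_prop

lemma gammaArg_re (b α : ℂ) : (gammaArg b α).re = -((α - b).im / (2 * Real.pi)) := by
  have hpi := Real.pi_ne_zero
  have h : gammaArg b α = ((α - b).im * -(1 / (2 * Real.pi)) : ℝ)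
      + ((α - b).re / (2 * Real.pi) : ℝ) * Complex.I := by
    rw [gammaArg_eq_iff]
    conv_lhs => rw [← sub_add_cancel α b, ← Complex.re_add_im (α - b)]
    have hI := Complex.I_sq
    push_cast
    field_simp
    linear_combination ((α - b).re : ℂ) * hI
  rw [h]
  simp only [Complex.add_re, Complex.ofReal_re, Complex.re_ofReal_mul, Complex.I_re]
  ring

lemma gammaArg_mul_two_pi_I (b α : ℂ) :
    gammaArg b α * (2 * Real.pi * Complex.I) = -(α - b) := by
  rw [gammaArg]
  have := neg_two_pi_I_ne_zero
  field_simp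

lemma gammaQuot_eq_mul_div {w : ℂ} (hw : w - 1 / 2 ≠ 0) :
    gammaQuot w = gammaQuot (w + 1) * ((w + 1) / (w - 1 / 2)) := by
  unfold gammaQuot
  have e : w + 1 - 1 / 2 = w - 1 / 2 + 1 := by ring
  rw [e, Complex.Gamma_add_one _ hw]
  rcases eq_or_ne (w + 1) 0 with h | h
  -- At `w = -1` the left side is `0` by the default value `Γ(0) = 0`, which agrees with the zero of
  -- `1/Γ`; on the right the factor `w + 1` vanishes.
  · rw [h]
    simp
  · rw [Complex.Gamma_add_one _ h]
    generalize w - 1 / 2 = a at *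
    field_simp

lemma gammaQuot_eq_mul_prod {w : ℂ} (m : ℕ) (hw : ∀ k : ℕ, w - 1 / 2 + k ≠ 0) :
    gammaQuot w = gammaQuot (w + m)
      * ∏ k ∈ Finset.range m, (w + 1 + k) / (w - 1 / 2 + k) := by
  induction m with
  | zero => simp
  | succ m ih =>
    have h1 : w + m - 1 / 2 ≠ 0 := by
      have := hw m
      rwa [sub_add_eq_add_sub] at this
    rw [Finset.prod_range_succ, ih, gammaQuot_eq_mul_div h1]
    push_cast
    rw [add_assoc w m 1, add_right_comm w 1 (m : ℂ), add_assoc w m 1, sub_add_eq_add_sub w (1 / 2)]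
    ring

lemma norm_affine_div_le {L : ℝ} (a b : ℂ) : ∃ C : ℝ, 0 ≤ C ∧ ∀ z : ℂ, L < z.im →
    ‖(a * z + b) / (z - (L - 1 : ℝ) * Complex.I)‖ ≤ C := by
  set p : ℂ := (L - 1 : ℝ) * Complex.I with hp
  refine ⟨‖a‖ + ‖a * p + b‖, by positivity, fun z hz => ?_⟩
  have h1 : 1 ≤ ‖z - p‖ := by
    refine le_trans ?_ (Complex.abs_im_le_norm _)
    refine le_trans ?_ (le_abs_self _)
    simp [hp]
    linarith
  have hne : z - p ≠ 0 := norm_pos_iff.mp (by linarith)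
  have e : (a * z + b) / (z - p) = a + (a * p + b) / (z - p) := by
    field_simp
    ring
  rw [e]
  refine (norm_add_le _ _).trans ?_
  gcongr
  rw [norm_div]
  exact div_le_self (norm_nonneg _) h1

/-- On a half plane, `gammaQuot (1/2 - gammaArg b z)` is the product of a holomorphic function of
size `O(|z|^{-3/2})` and finitely many factors which account for the poles. -/
lemma exists_gammaQuot_factorization (L : ℝ) (b : ℂ) :
    ∃ (m : ℕ) (h : ℂ → ℂ), DifferentiableOn ℂ h {z | L < z.im} ∧
      (∃ C : ℝ, 0 ≤ C ∧ ∀ z : ℂ, L < z.im → ‖h z‖ ≤ C * (1 + ‖z‖) ^ (-(3 / 2) : ℝ)) ∧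
      ∀ z : ℂ, L < z.im → (∀ k : ℕ, z ≠ b - 2 * Real.pi * Complex.I * k) →
        gammaQuot (1 / 2 - gammaArg b z) = h z * ∏ k ∈ Finset.range m,
          (z - (L - 1 : ℝ) * Complex.I) / (z - (b - 2 * Real.pi * Complex.I * k)) := by
  set p : ℂ := (L - 1 : ℝ) * Complex.I with hp
  have hpi := Real.pi_pos
  -- With this `m` the shifted argument has real part at least `1` on the whole half plane, where
  -- the decay estimate holds; the recurrence brings the argument back at the cost of `m` rational
  -- factors.
  obtain ⟨m, hm⟩ := exists_nat_ge (1 / 2 + (b.im - L) / (2 * Real.pi))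
  let w : ℂ → ℂ := fun z => 1 / 2 - gammaArg b z
  have hwd : Differentiable ℂ w := (differentiable_gammaArg b).const_sub _
  have hre : ∀ z : ℂ, L < z.im → 1 ≤ (w z + m).re := by
    intro z hz
    have h1 : (w z + m).re = 1 / 2 + (z.im - b.im) / (2 * Real.pi) + m := by
      simp [w, gammaArg_re]
    have h2 : (L - b.im) / (2 * Real.pi) ≤ (z.im - b.im) / (2 * Real.pi) := by gcongr
    have h3 : (L - b.im) / (2 * Real.pi) = -((b.im - L) / (2 * Real.pi)) := by ring
    rw [h1]
    linarith
  have hpne : ∀ z : ℂ, L < z.im → z - p ≠ 0 := by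
    intro z hz h0
    have := congrArg Complex.im h0
    simp [hp] at this
    linarith
  let c : ℂ := 2 * Real.pi * Complex.I
  -- The auxiliary point `p` lies at depth `1` below the half plane. Division by `z - p` makes each
  -- numerator of the recurrence bounded and creates no pole in the half plane.
  refine ⟨m, fun z => gammaQuot (w z + m) * ∏ k ∈ Finset.range m, c * (w z + 1 + k) / (z - p),
    ?_, ?_, ?_⟩
  · intro z hz
    apply DifferentiableAt.differentiableWithinAt
    have h1 : DifferentiableAt ℂ (fun z => gammaQuot (w z + m)) z :=
      (differentiableAt_gammaQuot (by linarith [hre z hz])).comp (f := fun z => w z + m) z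
        (hwd z |>.add_const _)
    refine h1.mul (DifferentiableAt.fun_finsetProd fun k _ => ?_)
    have := hwd z
    have := hpne z hz
    fun_prop (disch := assumption)
  · obtain ⟨C, hC0, hC⟩ := exists_norm_gammaQuot_le
    have hk : ∀ k : ℕ, ∃ C : ℝ, 0 ≤ C ∧ ∀ z : ℂ, L < z.im →
        ‖c * (w z + 1 + k) / (z - p)‖ ≤ C := by
      intro k
      obtain ⟨C, hC0, hC⟩ := norm_affine_div_le (L := L) 1 (c * (1 / 2 + 1 + k) - b)
      refine ⟨C, hC0, fun z hz => ?_⟩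
      convert hC z hz using 3
      have := gammaArg_mul_two_pi_I b z
      simp only [w, c]
      linear_combination -this
    choose D hD0 hD using hk
    let B : ℝ := 1 + 2 * Real.pi + ‖b - c * (1 / 2 + m)‖
    have hB : 0 < B := by positivity
    have hwz : ∀ z : ℂ, L < z.im → 1 + ‖z‖ ≤ B * ‖w z + m‖ := by
      intro z hz
      have h1 : 1 ≤ ‖w z + m‖ := (hre z hz).trans (Complex.re_le_norm _)
      have h2 : z = c * (w z + m) + (b - c * (1 / 2 + m)) := by
        have := gammaArg_mul_two_pi_I b z
        simp only [w, c]
        linear_combination this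
      have h3 : ‖z‖ ≤ 2 * Real.pi * ‖w z + m‖ + ‖b - c * (1 / 2 + m)‖ := by
        conv_lhs => rw [h2]
        refine (norm_add_le _ _).trans ?_
        rw [norm_mul]
        gcongr
        simp [c, abs_of_pos hpi]
      have h4 := mul_le_mul_of_nonneg_left h1 (norm_nonneg (b - c * (1 / 2 + m)))
      simp only [B]
      linarith
    refine ⟨C * B ^ (3 / 2 : ℝ) * ∏ k ∈ Finset.range m, D k, by
      have := Finset.prod_nonneg fun k (_ : k ∈ Finset.range m) => hD0 k
      positivity, fun z hz => ?_⟩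
    rw [norm_mul, norm_prod]
    have h1 : ∏ k ∈ Finset.range m, ‖c * (w z + 1 + k) / (z - p)‖ ≤ ∏ k ∈ Finset.range m, D k :=
      Finset.prod_le_prod (fun _ _ => norm_nonneg _) fun k _ => hD k z hz
    have h2 : ‖gammaQuot (w z + m)‖ ≤ C * (B ^ (3 / 2 : ℝ) * (1 + ‖z‖) ^ (-(3 / 2) : ℝ)) := by
      refine (hC _ (hre z hz)).trans ?_
      have hw0 : 0 < ‖w z + m‖ := lt_of_lt_of_le one_pos ((hre z hz).trans (Complex.re_le_norm _))
      have hz0 : 0 < 1 + ‖z‖ := by positivity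
      gcongr
      rw [Real.rpow_neg hw0.le, Real.rpow_neg hz0.le, ← div_eq_mul_inv,
        ← Real.div_rpow hB.le hz0.le, ← Real.inv_rpow hw0.le]
      apply Real.rpow_le_rpow (by positivity) _ (by norm_num)
      rw [le_div_iff₀ hz0, inv_mul_le_iff₀ hw0, mul_comm]
      exact hwz z hz
    calc _ ≤ C * (B ^ (3 / 2 : ℝ) * (1 + ‖z‖) ^ (-(3 / 2) : ℝ)) * ∏ k ∈ Finset.range m, D k := by
          gcongr
      _ = _ := by ring
  · intro z hz hzk
    have hpole : ∀ k : ℕ, c * (w z - 1 / 2 + k) = z - (b - 2 * Real.pi * Complex.I * k) := by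
      intro k
      have := gammaArg_mul_two_pi_I b z
      simp only [w, c]
      linear_combination -this
    have hpk : ∀ k : ℕ, w z - 1 / 2 + k ≠ 0 := by
      intro k h0
      have := hpole k
      rw [h0, mul_zero] at this
      exact hzk k (sub_eq_zero.mp this.symm)
    change gammaQuot (w z) = _
    rw [gammaQuot_eq_mul_prod m hpk, mul_assoc, ← Finset.prod_mul_distrib]
    congr 1
    refine Finset.prod_congr rfl fun k _ => ?_
    rw [← hpole k]
    have h1 := hpne z hz
    have h2 := hpk k
    have h3 : c ≠ 0 := by simp [c, Real.pi_ne_zero]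
    field_simp

lemma rpow_neg_three_halves_pow {x : ℝ} (hx : 0 < x) {n d : ℕ} (hd : d + 2 = 3 * n) :
    (x ^ (-(3 / 2) : ℝ)) ^ (2 * n) * x ^ d = x ^ (-2 : ℝ) := by
  rw [← Real.rpow_natCast, ← Real.rpow_mul hx.le, ← Real.rpow_natCast, ← Real.rpow_add hx]
  congr 1
  have : (d : ℝ) + 2 = 3 * n := by exact_mod_cast hd
  push_cast
  linarith

lemma TameCurve.exists_lt_im {γ : ℝ → ℂ} (h : TameCurve γ) : ∃ L : ℝ, ∀ t, L < (γ t).im := by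
  obtain ⟨D, hD0, hD⟩ := h.bounded
  refine ⟨-D - 1, fun t => ?_⟩
  have := (abs_le.mp ((Complex.abs_im_le_norm _).trans (hD t))).1
  simp at this
  linarith

/-- The poles `β_j - 2πik` are below the curve. On an upper half plane containing it, after removal
of the finitely many pole factors, the `2n` quotients contribute `|z|^{-3n}` against `|z|^{3n-2}`
from `Q`. -/
lemma TameCurve.integral_gammaQuot_half_sub_eq_zero {γ : ℝ → ℂ} (h : TameCurve γ) {n d : ℕ}
    (hd : d + 2 = 3 * n) {β : Fin (2 * n) → ℂ}
    (hb : ∀ j (k : ℕ), LiesBelow γ (β j - 2 * Real.pi * Complex.I * k))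
    {Q : ℂ → ℂ} (hQ : Differentiable ℂ Q) {C : ℝ} (hC : ∀ z, ‖Q z‖ ≤ C * (1 + ‖z‖) ^ d) :
    ∫ t, deriv γ t * (Q (γ t) * ∏ j, gammaQuot (1 / 2 - gammaArg (β j) (γ t))) = 0 := by
  obtain ⟨L, hL⟩ := h.exists_lt_im
  choose m f hfd hfC hf using fun j => exists_gammaQuot_factorization L (β j)
  choose B hB0 hB using hfC
  have hC0 : 0 ≤ C := by
    have := (norm_nonneg _).trans (hC 0)
    simpa using this
  have h0 := h.integral_eq_zero_of_liesBelow_finset hL ((L - 1 : ℝ) * Complex.I)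
    (s := Finset.univ.sigma fun j => Finset.range (m j))
    (p := fun i => β i.1 - 2 * Real.pi * Complex.I * i.2)
    (H := fun z => Q z * ∏ j, f j z) (C := C * ∏ j, B j) (fun i _ => hb i.1 i.2)
    (hQ.differentiableOn.mul (DifferentiableOn.fun_finsetProd fun j _ => hfd j))
    (by
      have := Finset.prod_nonneg fun j (_ : j ∈ Finset.univ) => hB0 j
      positivity)
    (fun z hz => by
      have hz0 : 0 < 1 + ‖z‖ := by positivity
      rw [norm_mul, norm_prod]
      calc _ ≤ (C * (1 + ‖z‖) ^ d) * ∏ j, (B j * (1 + ‖z‖) ^ (-(3 / 2) : ℝ)) := by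
            gcongr
            · exact hC z
            · exact hB _ z hz
        _ = C * (∏ j, B j) * (((1 + ‖z‖) ^ (-(3 / 2) : ℝ)) ^ (2 * n) * (1 + ‖z‖) ^ d) := by
            rw [Finset.prod_mul_distrib, Finset.prod_const, Finset.card_univ, Fintype.card_fin]
            ring
        _ = _ := by rw [rpow_neg_three_halves_pow hz0 hd])
  rw [← h0]
  congr 1
  ext t
  rw [Finset.prod_sigma, mul_assoc, mul_assoc, ← Finset.prod_mul_distrib]
  congr 2
  refine Finset.prod_congr rfl fun j _ => ?_
  exact hf j (γ t) (hL t) fun k hk => (hb j k).notMem ⟨t, hk⟩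

/-- The half-turn together with `b ↦ -b + πi` exchanges `z` and `1/2 - z`, and hence the two
families of poles. -/
lemma half_sub_gammaArg (b α : ℂ) :
    1 / 2 - gammaArg (-b + Real.pi * Complex.I) (-α) = gammaArg b α := by
  unfold gammaArg
  have := neg_two_pi_I_ne_zero
  field_simp
  ring

lemma LiesAbove.neg_add_pi_I {γ : ℝ → ℂ} {b : ℂ} {k : ℕ}
    (h : LiesAbove γ (b - Real.pi * Complex.I + 2 * Real.pi * Complex.I * k)) :
    LiesBelow (fun t => -γ (-t)) (-b + Real.pi * Complex.I - 2 * Real.pi * Complex.I * k) := by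
  have := h.neg
  convert this using 1
  ring

lemma TameCurve.integral_gammaQuot_eq_zero {γ : ℝ → ℂ} (h : TameCurve γ) {n d : ℕ}
    (hd : d + 2 = 3 * n) {β : Fin (2 * n) → ℂ}
    (ha : ∀ j (k : ℕ),
      LiesAbove γ (β j - Real.pi * Complex.I + 2 * Real.pi * Complex.I * k))
    {Q : ℂ → ℂ} (hQ : Differentiable ℂ Q) {C : ℝ} (hC : ∀ z, ‖Q z‖ ≤ C * (1 + ‖z‖) ^ d) :
    ∫ t, deriv γ t * (Q (γ t) * ∏ j, gammaQuot (gammaArg (β j) (γ t))) = 0 := by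
  have h0 := h.neg.integral_gammaQuot_half_sub_eq_zero hd
    (β := fun j => -β j + Real.pi * Complex.I) (fun j k => (ha j k).neg_add_pi_I)
    (Q := fun z => Q (-z)) (hQ.comp differentiable_neg) (C := C) (fun z => by simpa using hC (-z))
  rw [← MeasureTheory.integral_neg_eq_self] at h0
  simpa only [deriv_neg_comp_neg, neg_neg, half_sub_gammaArg] using h0

lemma TameCurve.exists_norm_gammaQuot_half_sub_le {γ : ℝ → ℂ} (h : TameCurve γ) {b : ℂ}
    (hb : ∀ k : ℕ, LiesBelow γ (b - 2 * Real.pi * Complex.I * k)) :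
    ∃ C : ℝ, 0 ≤ C ∧
      ∀ t, ‖gammaQuot (1 / 2 - gammaArg b (γ t))‖ ≤ C * (1 + |t|) ^ (-(3 / 2) : ℝ) := by
  obtain ⟨L, hL⟩ := h.exists_lt_im
  obtain ⟨m, f, hfd, ⟨B, hB0, hB⟩, hf⟩ := exists_gammaQuot_factorization L b
  obtain ⟨c, hc, hγ⟩ := h.exists_one_add_abs_le
  have hk : ∀ k : ℕ, ∃ C : ℝ, 0 ≤ C ∧ ∀ t, ‖(γ t - (L - 1 : ℝ) * Complex.I) /
      (γ t - (b - 2 * Real.pi * Complex.I * k))‖ ≤ C := by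
    intro k
    set p := b - 2 * Real.pi * Complex.I * k with hp
    obtain ⟨C, hC⟩ := exists_norm_div_sub_le h.isClosed_range (hb k).notMem
    have hC0 : 0 ≤ C := (norm_nonneg _).trans (hC 0)
    refine ⟨1 + ‖p - (L - 1 : ℝ) * Complex.I‖ * C, by positivity, fun t => ?_⟩
    have hne : γ t - p ≠ 0 := fun h0 => (hb k).notMem ⟨t, sub_eq_zero.mp h0⟩
    have e : (γ t - (L - 1 : ℝ) * Complex.I) / (γ t - p)
        = 1 + (p - (L - 1 : ℝ) * Complex.I) * (γ t - p)⁻¹ := by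
      field_simp
      ring
    rw [e]
    refine (norm_add_le _ _).trans ?_
    rw [norm_one, norm_mul]
    gcongr
    exact hC t
  choose D hD0 hD using hk
  refine ⟨B * c ^ (3 / 2 : ℝ) * ∏ k ∈ Finset.range m, D k, by
    have := Finset.prod_nonneg fun k (_ : k ∈ Finset.range m) => hD0 k
    positivity, fun t => ?_⟩
  rw [hf (γ t) (hL t) fun k hk => (hb k).notMem ⟨t, hk⟩, norm_mul, norm_prod]
  have h0 : 0 < 1 + ‖γ t‖ := by positivity
  have h1 : 0 < 1 + |t| := by positivity
  have h2 : (1 + ‖γ t‖) ^ (-(3 / 2) : ℝ) ≤ c ^ (3 / 2 : ℝ) * (1 + |t|) ^ (-(3 / 2) : ℝ) := by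
    rw [Real.rpow_neg h0.le, Real.rpow_neg h1.le, ← div_eq_mul_inv, inv_le_comm₀ (by positivity)
      (by positivity), inv_div, div_le_iff₀ (by positivity), ← Real.mul_rpow h0.le hc.le]
    apply Real.rpow_le_rpow h1.le _ (by norm_num)
    linarith [(hγ t).1]
  calc _ ≤ (B * (c ^ (3 / 2 : ℝ) * (1 + |t|) ^ (-(3 / 2) : ℝ))) * ∏ k ∈ Finset.range m, D k := by
        gcongr
        · exact (hB _ (hL t)).trans (by gcongr)
        · exact hD _ t
    _ = _ := by ring

lemma TameCurve.exists_norm_gammaQuot_le {γ : ℝ → ℂ} (h : TameCurve γ) {b : ℂ}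
    (ha : ∀ k : ℕ, LiesAbove γ (b - Real.pi * Complex.I + 2 * Real.pi * Complex.I * k)) :
    ∃ C : ℝ, 0 ≤ C ∧ ∀ t, ‖gammaQuot (gammaArg b (γ t))‖ ≤ C * (1 + |t|) ^ (-(3 / 2) : ℝ) := by
  obtain ⟨C, hC0, hC⟩ := h.neg.exists_norm_gammaQuot_half_sub_le
    (b := -b + Real.pi * Complex.I) fun k => (ha k).neg_add_pi_I
  refine ⟨C, hC0, fun t => ?_⟩
  have := hC (-t)
  simpa only [neg_neg, half_sub_gammaArg, abs_neg] using this

/-! ### The regularized kernel of one rapidity. -/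

/-- `Γ(z - 1/2) Γ(-z) e^{-πiz}`. -/
def gammaKernel (z : ℂ) : ℂ :=
  Complex.Gamma (z - 1 / 2) * Complex.Gamma (-z) * Complex.exp (-(Real.pi * Complex.I * z))

lemma exp_gammaArg (b α : ℂ) :
    Complex.exp (2 * Real.pi * Complex.I * gammaArg b α)
      = Complex.exp (-α) * (Complex.exp (-b))⁻¹ := by
  rw [mul_comm, gammaArg_mul_two_pi_I, ← Complex.exp_neg, ← Complex.exp_add]
  ring_nf

lemma one_sub_exp_eq_sin (z : ℂ) : 1 - Complex.exp (2 * Real.pi * Complex.I * z)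
    = -2 * Complex.I * Complex.sin (Real.pi * z) * Complex.exp (Real.pi * Complex.I * z) := by
  have h1 : Complex.exp (2 * Real.pi * Complex.I * z) = Complex.exp (Real.pi * Complex.I * z) ^ 2 := by
    rw [← Complex.exp_nat_mul]
    ring_nf
  have h2 : Complex.exp (-(Real.pi * z) * Complex.I) = (Complex.exp (Real.pi * Complex.I * z))⁻¹ := by
    rw [← Complex.exp_neg]
    ring_nf
  have h3 : Complex.exp (Real.pi * z * Complex.I) = Complex.exp (Real.pi * Complex.I * z) := by
    ring_nf
  rw [Complex.sin, h1, h2, h3]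
  have := Complex.exp_ne_zero (Real.pi * Complex.I * z)
  field_simp
  linear_combination (1 - Complex.exp (Real.pi * Complex.I * z) ^ 2) * Complex.I_sq

lemma one_add_exp_eq_cos (z : ℂ) : 1 + Complex.exp (2 * Real.pi * Complex.I * z)
    = 2 * Complex.cos (Real.pi * z) * Complex.exp (Real.pi * Complex.I * z) := by
  have h1 : Complex.exp (2 * Real.pi * Complex.I * z) = Complex.exp (Real.pi * Complex.I * z) ^ 2 := by
    rw [← Complex.exp_nat_mul]
    ring_nf
  have h2 : Complex.exp (-(Real.pi * z) * Complex.I) = (Complex.exp (Real.pi * Complex.I * z))⁻¹ := by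
    rw [← Complex.exp_neg]
    ring_nf
  have h3 : Complex.exp (Real.pi * z * Complex.I) = Complex.exp (Real.pi * Complex.I * z) := by
    ring_nf
  rw [Complex.cos, h1, h2, h3]
  have := Complex.exp_ne_zero (Real.pi * Complex.I * z)
  field_simp
  ring

/-- The zeros of `1 - e^{2πiz}` cancel the poles of `Γ(-z)`. Only those of `Γ(z - 1/2)` remain, at
points above the contour. -/
lemma gammaKernel_mul_one_sub {z : ℂ} (hz : ∀ k : ℕ, z ≠ k) :
    gammaKernel z * (1 - Complex.exp (2 * Real.pi * Complex.I * z))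
      = 2 * Real.pi * Complex.I * gammaQuot z := by
  have h1 := Complex.Gamma_mul_Gamma_one_sub (-z)
  rw [sub_neg_eq_add, mul_neg, Complex.sin_neg, add_comm 1 z] at h1
  rw [one_sub_exp_eq_sin, gammaKernel, Complex.exp_neg, gammaQuot]
  have he := Complex.exp_ne_zero (Real.pi * Complex.I * z)
  -- Under the hypothesis on `z`, this forces `z` to be a negative integer. Then `Γ(z + 1)` has the
  -- default value `0`, and both sides vanish.
  by_cases hs : Complex.sin (Real.pi * z) = 0
  · have : Complex.Gamma (z + 1) = 0 := by
      obtain ⟨k, hk⟩ := Complex.sin_eq_zero_iff.mp hs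
      have hzk : z = k := by
        have hpi : (Real.pi : ℂ) ≠ 0 := by simp [Real.pi_ne_zero]
        apply mul_left_cancel₀ hpi
        rw [hk, mul_comm]
      have hk0 : k < 0 := by
        by_contra hn
        obtain ⟨m, rfl⟩ := Int.eq_ofNat_of_zero_le (not_lt.mp hn)
        exact hz m (by simpa using hzk)
      rw [Complex.Gamma_eq_zero_iff]
      obtain ⟨m, hm⟩ := Int.eq_ofNat_of_zero_le (show 0 ≤ -k - 1 by omega)
      refine ⟨m, ?_⟩
      rw [hzk]
      have : ((m : ℤ) : ℂ) = -k - 1 := by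
        have h2 : (m : ℤ) = -k - 1 := hm.symm
        rw [h2]
        push_cast
        ring
      rw [Int.cast_natCast] at this
      rw [this]
      ring
    rw [hs, this]
    simp
  · have hG : Complex.Gamma (z + 1) ≠ 0 := by
      intro h0
      rw [h0, mul_zero, eq_comm, div_eq_zero_iff] at h1
      rcases h1 with h1 | h1
      · exact Real.pi_ne_zero (by exact_mod_cast h1)
      · exact hs (neg_eq_zero.mp h1)
    have h2 : Complex.Gamma (-z) * Complex.Gamma (z + 1) * Complex.sin (Real.pi * z) = -Real.pi := by
      rw [h1]
      field_simp
    generalize Complex.Gamma (z - 1 / 2) = G1 at *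
    generalize Complex.sin (Real.pi * z) = s at *
    field_simp
    linear_combination -G1 * h2

/-- The zeros of `1 + e^{2πiz}` cancel the poles of `Γ(z - 1/2)`. Only those of `Γ(-z)` remain, at
points below the contour. -/
lemma gammaKernel_mul_one_add {z : ℂ} (hz : ∀ k : ℕ, z ≠ 1 / 2 - k) :
    gammaKernel z * (1 + Complex.exp (2 * Real.pi * Complex.I * z))
      = -2 * Real.pi * gammaQuot (1 / 2 - z) := by
  have h1 := Complex.Gamma_mul_Gamma_one_sub (z - 1 / 2)
  have e1 : 1 - (z - 1 / 2) = 1 / 2 - z + 1 := by ring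
  have e2 : Complex.sin (Real.pi * (z - 1 / 2)) = -Complex.cos (Real.pi * z) := by
    rw [← Complex.sin_sub_pi_div_two]
    ring_nf
  have e3 : 1 / 2 - z - 1 / 2 = -z := by ring
  rw [e1, e2] at h1
  rw [one_add_exp_eq_cos, gammaKernel, Complex.exp_neg, gammaQuot, e3]
  have he := Complex.exp_ne_zero (Real.pi * Complex.I * z)
  by_cases hs : Complex.cos (Real.pi * z) = 0
  · have : Complex.Gamma (1 / 2 - z + 1) = 0 := by
      obtain ⟨k, hk⟩ := Complex.cos_eq_zero_iff.mp hs
      have hzk : z = k + 1 / 2 := by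
        have hpi : (Real.pi : ℂ) ≠ 0 := by simp [Real.pi_ne_zero]
        apply mul_left_cancel₀ hpi
        rw [hk]
        ring
      have hk0 : 0 < k := by
        by_contra hn
        obtain ⟨m, hm⟩ := Int.eq_ofNat_of_zero_le (show 0 ≤ -k by omega)
        apply hz m
        have h3 : ((m : ℤ) : ℂ) = -k := by
          rw [show (m : ℤ) = -k from hm.symm]
          push_cast
          ring
        rw [Int.cast_natCast] at h3
        rw [hzk, h3]
        ring
      rw [Complex.Gamma_eq_zero_iff]
      obtain ⟨m, hm⟩ := Int.eq_ofNat_of_zero_le (show 0 ≤ k - 1 by omega)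
      refine ⟨m, ?_⟩
      have : ((m : ℤ) : ℂ) = k - 1 := by
        rw [show (m : ℤ) = k - 1 from hm.symm]
        push_cast
        ring
      rw [Int.cast_natCast] at this
      rw [this, hzk]
      ring
    rw [hs, this]
    simp
  · have hG : Complex.Gamma (1 / 2 - z + 1) ≠ 0 := by
      intro h0
      rw [h0, mul_zero, eq_comm, div_eq_zero_iff] at h1
      rcases h1 with h1 | h1
      · exact Real.pi_ne_zero (by exact_mod_cast h1)
      · exact hs (neg_eq_zero.mp h1)
    have h2 : Complex.Gamma (z - 1 / 2) * Complex.Gamma (1 / 2 - z + 1) * Complex.cos (Real.pi * z)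
        = -Real.pi := by
      rw [h1]
      field_simp
    generalize Complex.Gamma (z - 1 / 2) = G1 at *
    generalize Complex.Gamma (1 / 2 - z + 1) = G2 at *
    generalize Complex.cos (Real.pi * z) = s at *
    field_simp
    linear_combination Complex.Gamma (-z) * h2

/-- The kernel regularizes the product of the factors of `phi`, of the rational function and of
the cycle which belong to one rapidity. -/
lemma gamma_div_gamma_eq_gammaKernel {z : ℂ} (hz : ∀ k : ℤ, z ≠ k) :
    Complex.Gamma (z - 1 / 2) / Complex.Gamma z
        / (-2 * Real.pi * Complex.I * z * (1 - Complex.exp (2 * Real.pi * Complex.I * z)))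
      = gammaKernel z / (4 * Real.pi ^ 2) := by
  have hz0 : z ≠ 0 := by simpa using hz 0
  have hs : Complex.sin (Real.pi * z) ≠ 0 := by
    rw [Ne, Complex.sin_eq_zero_iff]
    rintro ⟨k, hk⟩
    apply hz k
    have hpi : (Real.pi : ℂ) ≠ 0 := by simp [Real.pi_ne_zero]
    apply mul_left_cancel₀ hpi
    rw [hk, mul_comm]
  have hG : Complex.Gamma z ≠ 0 := by
    rw [Ne, Complex.Gamma_eq_zero_iff]
    rintro ⟨m, hm⟩
    exact hz (-m) (by simpa using hm)
  have h1 := Complex.Gamma_mul_Gamma_one_sub z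
  have h2 : Complex.Gamma (1 - z) = -z * Complex.Gamma (-z) := by
    rw [← Complex.Gamma_add_one _ (neg_ne_zero.mpr hz0)]
    ring_nf
  rw [h2] at h1
  have h3 : Complex.Gamma (-z) * (z * Complex.Gamma z * Complex.sin (Real.pi * z)) = -Real.pi := by
    have : Complex.Gamma (-z) * (z * Complex.Gamma z * Complex.sin (Real.pi * z))
      = -(Complex.Gamma z * (-z * Complex.Gamma (-z))) * Complex.sin (Real.pi * z) := by ring
    rw [this, h1]
    field_simp
  rw [one_sub_exp_eq_sin, gammaKernel, Complex.exp_neg]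
  have he := Complex.exp_ne_zero (Real.pi * Complex.I * z)
  have hpi : (Real.pi : ℂ) ≠ 0 := by simp [Real.pi_ne_zero]
  have hI := Complex.I_ne_zero
  generalize Complex.Gamma (z - 1 / 2) = G1 at *
  field_simp
  linear_combination -4 * G1 * Complex.I ^ 2 * h3 + 4 * Real.pi * G1 * Complex.I_sq

lemma IsContour.gammaArg_ne_natCast {N : ℕ} {β : Fin N → ℂ} {γ : ℝ → ℂ} (h : IsContour β γ)
    (j : Fin N) (t : ℝ) (k : ℕ) : gammaArg (β j) (γ t) ≠ k := fun h0 =>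
  (h.below j k).notMem ⟨t, gammaArg_eq_iff.mp h0⟩

lemma IsContour.gammaArg_ne_half_sub {N : ℕ} {β : Fin N → ℂ} {γ : ℝ → ℂ} (h : IsContour β γ)
    (j : Fin N) (t : ℝ) (k : ℕ) : gammaArg (β j) (γ t) ≠ 1 / 2 - k := fun h0 => by
  refine (h.above j k).notMem ⟨t, ?_⟩
  rw [gammaArg_eq_iff.mp h0]
  ring

lemma IsContour.ne_rapidity {N : ℕ} {β : Fin N → ℂ} {γ : ℝ → ℂ} (h : IsContour β γ)
    (j : Fin N) (t : ℝ) : γ t - β j ≠ 0 := fun h0 => by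
  refine (h.below j 0).notMem ⟨t, ?_⟩
  rw [sub_eq_zero.mp h0]
  simp

lemma continuousAt_gammaKernel {z : ℂ} (h1 : ∀ k : ℕ, z ≠ k) (h2 : ∀ k : ℕ, z ≠ 1 / 2 - k) :
    ContinuousAt gammaKernel z := by
  have e1 : ContinuousAt (fun z : ℂ => Complex.Gamma (z - 1 / 2)) z := by
    refine ContinuousAt.comp (f := fun z : ℂ => z - 1 / 2) (g := Complex.Gamma)
      (Complex.differentiableAt_Gamma _ fun m hm => h2 m ?_).continuousAt (by fun_prop)
    linear_combination hm
  have e2 : ContinuousAt (fun z : ℂ => Complex.Gamma (-z)) z := by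
    refine ContinuousAt.comp (f := fun z : ℂ => -z) (g := Complex.Gamma)
      (Complex.differentiableAt_Gamma _ fun m hm => h1 m ?_).continuousAt (by fun_prop)
    linear_combination -hm
  exact (e1.mul e2).mul (by fun_prop)

lemma IsContour.continuous_gammaKernel {N : ℕ} {β : Fin N → ℂ} {γ : ℝ → ℂ} (h : IsContour β γ)
    (j : Fin N) : Continuous fun t => gammaKernel (gammaArg (β j) (γ t)) := by
  rw [continuous_iff_continuousAt]
  intro t
  exact (continuousAt_gammaKernel (h.gammaArg_ne_natCast j t) (h.gammaArg_ne_half_sub j t)).comp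
    (f := fun t => gammaArg (β j) (γ t))
    (((differentiable_gammaArg (β j)).continuous.comp h.continuous).continuousAt)

lemma TameCurve.exists_norm_exp_neg_le {γ : ℝ → ℂ} (h : TameCurve γ) :
    ∃ c : ℝ, 1 ≤ c ∧ ∀ t, ‖Complex.exp (-γ t)‖ ≤ c * Real.exp (-t) ∧
      Real.exp (-t) ≤ c * ‖Complex.exp (-γ t)‖ := by
  obtain ⟨D, hD0, hD⟩ := h.bounded
  refine ⟨Real.exp D, Real.one_le_exp hD0, fun t => ?_⟩
  have := abs_le.mp ((Complex.abs_re_le_norm _).trans (hD t))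
  simp at this
  rw [Complex.norm_exp, ← Real.exp_add, ← Real.exp_add, Complex.neg_re]
  constructor <;> apply Real.exp_le_exp.mpr <;> linarith

/-- If `y ≤ c e^{-t}` and `e^{-t} ≤ c y` then `|1 - y|` is comparable to `1 + e^{-t}` for large
`|t|`. -/
lemma exists_one_add_exp_neg_le {f : ℝ → ℂ} {c : ℝ} (hc : 1 ≤ c)
    (hf : ∀ t, ‖f t‖ ≤ c * Real.exp (-t) ∧ Real.exp (-t) ≤ c * ‖f t‖) :
    ∃ T : ℝ, ∀ t, T ≤ |t| → 1 + Real.exp (-t) ≤ 4 * c * ‖1 - f t‖ := by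
  refine ⟨Real.log (2 * c), fun t ht => ?_⟩
  have h2c : 0 < 2 * c := by linarith
  rcases le_total 0 t with h | h
  · rw [abs_of_nonneg h] at ht
    have h1 : Real.exp (-t) ≤ (2 * c)⁻¹ := by
      rw [← Real.exp_log (inv_pos.mpr h2c), Real.log_inv]
      apply Real.exp_le_exp.mpr
      linarith
    have h2 : ‖f t‖ ≤ 1 / 2 := by
      refine (hf t).1.trans ?_
      calc _ ≤ c * (2 * c)⁻¹ := by gcongr
        _ = 1 / 2 := by field_simp
    have h3 : 1 - ‖f t‖ ≤ ‖1 - f t‖ := by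
      simpa using norm_sub_norm_le 1 (f t)
    have h4 : Real.exp (-t) ≤ 1 := Real.exp_le_one_iff.mpr (by linarith)
    nlinarith
  · rw [abs_of_nonpos h] at ht
    have h1 : 2 * c ≤ Real.exp (-t) := by
      rw [← Real.exp_log h2c]
      exact Real.exp_le_exp.mpr ht
    have h3 : ‖f t‖ - 1 ≤ ‖1 - f t‖ := by
      have := norm_sub_norm_le (f t) 1
      rwa [norm_one, norm_sub_rev] at this
    have h4 := (hf t).2
    nlinarith

lemma IsContour.exists_norm_gammaKernel_le {N : ℕ} {β : Fin N → ℂ} {γ : ℝ → ℂ}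
    (h : IsContour β γ) (j : Fin N) :
    ∃ C : ℝ, 0 ≤ C ∧ ∀ t, ‖gammaKernel (gammaArg (β j) (γ t))‖
      ≤ C * ((1 + |t|) ^ (-(3 / 2) : ℝ) * (1 + Real.exp (-t))⁻¹) := by
  have ht := h.tameCurve
  obtain ⟨c, hc, hexp⟩ := ht.exists_norm_exp_neg_le
  obtain ⟨C₁, hC₁0, hC₁⟩ := ht.exists_norm_gammaQuot_le (h.above j)
  set y : ℂ := (Complex.exp (-β j))⁻¹ with hy
  have hy0 : 0 < ‖y‖ := norm_pos_iff.mpr (inv_ne_zero (Complex.exp_ne_zero _))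
  -- One constant, at least `1`, for both comparisons of `‖A B_j⁻¹‖` with `e^{-t}`.
  let c' := c * (‖y‖ + ‖y‖⁻¹) + 1
  have hc0 : 0 < c := by linarith
  have hyi : 0 < ‖y‖⁻¹ := inv_pos.mpr hy0
  have hc' : 1 ≤ c' := by
    have : 0 ≤ c * (‖y‖ + ‖y‖⁻¹) := by positivity
    simp only [c']
    linarith
  obtain ⟨T, hT⟩ := exists_one_add_exp_neg_le (f := fun t => Complex.exp (-γ t) * y) hc' (by
    intro t
    rw [norm_mul]
    have h1 := hexp t
    have hE := Real.exp_pos (-t)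
    have hx : 0 ≤ ‖Complex.exp (-γ t)‖ := norm_nonneg _
    constructor
    · calc _ ≤ c * Real.exp (-t) * ‖y‖ := by
            gcongr
            exact h1.1
        _ ≤ c * Real.exp (-t) * ‖y‖ + (c * ‖y‖⁻¹ + 1) * Real.exp (-t) := by
            have : 0 ≤ (c * ‖y‖⁻¹ + 1) * Real.exp (-t) := by positivity
            linarith
        _ = _ := by ring
    · calc _ ≤ c * ‖Complex.exp (-γ t)‖ * (‖y‖⁻¹ * ‖y‖) := by
            rw [inv_mul_cancel₀ hy0.ne', mul_one]
            exact h1.2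
        _ ≤ c * ‖Complex.exp (-γ t)‖ * (‖y‖⁻¹ * ‖y‖)
            + (c * ‖y‖ + 1) * (‖Complex.exp (-γ t)‖ * ‖y‖) := by
            have : 0 ≤ (c * ‖y‖ + 1) * (‖Complex.exp (-γ t)‖ * ‖y‖) := by positivity
            linarith
        _ = _ := by ring)
  have hcont : Continuous fun t => gammaKernel (gammaArg (β j) (γ t)) :=
    h.continuous_gammaKernel j
  obtain ⟨C₂, hC₂⟩ := (isCompact_Icc (a := -T) (b := T)).exists_bound_of_continuousOn
    (f := fun t => ‖gammaKernel (gammaArg (β j) (γ t))‖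
      * ((1 + |t|) ^ (3 / 2 : ℝ) * (1 + Real.exp (-t)))) (by
    apply Continuous.continuousOn
    refine hcont.norm.mul (Continuous.mul ?_ (by fun_prop))
    exact Continuous.rpow_const (by fun_prop) fun t => Or.inl (by positivity))
  refine ⟨max C₂ (2 * Real.pi * C₁ * (4 * c')), le_trans (by
    have := Real.pi_pos
    positivity) (le_max_right _ _), fun t => ?_⟩
  have h1 : 0 < 1 + |t| := by positivity
  have h2 : 0 < 1 + Real.exp (-t) := by positivity
  rw [Real.rpow_neg h1.le, ← mul_inv, ← div_eq_mul_inv, le_div_iff₀ (by positivity)]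
  -- Far out, the kernel is the gamma quotient divided by `1 - A B_j⁻¹`, whose modulus is at least a
  -- constant times `1 + e^{-t}`. On the compact rest continuity suffices.
  by_cases hlt : T ≤ |t|
  · refine le_trans ?_ (le_max_right _ _)
    have hk := gammaKernel_mul_one_sub (h.gammaArg_ne_natCast j t)
    rw [exp_gammaArg] at hk
    have hkn := congrArg norm hk
    rw [norm_mul, norm_mul] at hkn
    have hn : ‖(2 * Real.pi * Complex.I : ℂ)‖ = 2 * Real.pi := by
      simp [abs_of_pos Real.pi_pos]
    rw [hn] at hkn
    have hT' := hT t hlt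
    have hq := hC₁ t
    rw [Real.rpow_neg h1.le, ← div_eq_mul_inv, le_div_iff₀ (by positivity)] at hq
    calc _ ≤ ‖gammaKernel (gammaArg (β j) (γ t))‖ * ((1 + |t|) ^ (3 / 2 : ℝ)
          * (4 * c' * ‖1 - Complex.exp (-γ t) * y‖)) := by gcongr
      _ = (‖gammaKernel (gammaArg (β j) (γ t))‖ * ‖1 - Complex.exp (-γ t) * y‖)
          * ((1 + |t|) ^ (3 / 2 : ℝ) * (4 * c')) := by ring
      _ = 2 * Real.pi * (‖gammaQuot (gammaArg (β j) (γ t))‖ * (1 + |t|) ^ (3 / 2 : ℝ)) * (4 * c') := by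
          rw [hkn]
          ring
      _ ≤ _ := by
          have := Real.pi_pos
          gcongr
  · refine le_trans ?_ (le_max_left _ _)
    have := hC₂ t (abs_le.mp (not_le.mp hlt).le)
    rw [Real.norm_of_nonneg (by positivity)] at this
    exact this

/-- The product over all rapidities of the regularized kernels. -/
def kernelProd {N : ℕ} (β : Fin N → ℂ) (α : ℂ) : ℂ := ∏ j, gammaKernel (gammaArg (β j) α)

lemma IsContour.continuous_kernelProd {N : ℕ} {β : Fin N → ℂ} {γ : ℝ → ℂ} (h : IsContour β γ) :
    Continuous fun t => kernelProd β (γ t) :=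
  continuous_finsetProd _ fun j _ => h.continuous_gammaKernel j

/-- The `N` factors `(1 + e^{-t})⁻¹` absorb `e^{-kt}` exactly when `k ≤ N`, leaving the algebraic
decay of the kernels. -/
lemma IsContour.exists_norm_kernelProd_mul_exp_pow_le {N : ℕ} {β : Fin N → ℂ} {γ : ℝ → ℂ}
    (h : IsContour β γ) {k : ℕ} (hk : k ≤ N) :
    ∃ C : ℝ, 0 ≤ C ∧ ∀ t, ‖kernelProd β (γ t) * Complex.exp (-γ t) ^ k‖
      ≤ C * ((1 + |t|) ^ (-(3 / 2) : ℝ)) ^ N := by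
  choose C hC0 hC using h.exists_norm_gammaKernel_le
  obtain ⟨c, hc, hexp⟩ := h.tameCurve.exists_norm_exp_neg_le
  refine ⟨(∏ j, C j) * c ^ k, by
    have := Finset.prod_nonneg fun j (_ : j ∈ Finset.univ) => hC0 j
    positivity, fun t => ?_⟩
  have hE : 0 < 1 + Real.exp (-t) := by positivity
  have h1 : Real.exp (-t) ^ k ≤ (1 + Real.exp (-t)) ^ N := by
    calc _ ≤ (1 + Real.exp (-t)) ^ k := by
          gcongr
          linarith
      _ ≤ _ := pow_le_pow_right₀ (by linarith [Real.exp_pos (-t)]) hk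
  rw [norm_mul, norm_pow, kernelProd, norm_prod]
  have hP : 0 ≤ ∏ j, C j := Finset.prod_nonneg fun j _ => hC0 j
  calc _ ≤ (∏ j, C j * ((1 + |t|) ^ (-(3 / 2) : ℝ) * (1 + Real.exp (-t))⁻¹))
        * (c * Real.exp (-t)) ^ k := by
        gcongr
        · refine Finset.prod_nonneg fun j _ => ?_
          have := hC0 j
          positivity
        · exact hC _ t
        · exact (hexp t).1
    _ = ((∏ j, C j) * c ^ k) * ((1 + |t|) ^ (-(3 / 2) : ℝ)) ^ N
        * (((1 + Real.exp (-t)) ^ N)⁻¹ * Real.exp (-t) ^ k) := by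
        rw [Finset.prod_mul_distrib, Finset.prod_const, Finset.card_univ, Fintype.card_fin, mul_pow,
          mul_pow, inv_pow]
        ring
    _ ≤ ((∏ j, C j) * c ^ k) * ((1 + |t|) ^ (-(3 / 2) : ℝ)) ^ N * 1 := by
        gcongr
        rw [inv_mul_le_iff₀ (by positivity), mul_one]
        exact h1
    _ = _ := mul_one _

/-! ### The linear relation between one-variable integrals. -/

/-- The elementary symmetric functions of the `B_j⁻¹`. -/
def esymmInv {N : ℕ} (β : Fin N → ℂ) (k : ℕ) : ℂ :=
  ∑ s ∈ Finset.powersetCard k Finset.univ, ∏ j ∈ s, (Complex.exp (-β j))⁻¹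

lemma prod_one_add_eq_sum_esymmInv {N : ℕ} (β : Fin N → ℂ) (x : ℂ) :
    ∏ j, (1 + x * (Complex.exp (-β j))⁻¹)
      = ∑ k ∈ Finset.range (N + 1), esymmInv β k * x ^ k := by
  rw [Finset.prod_one_add, Finset.sum_powerset, Finset.card_univ, Fintype.card_fin]
  refine Finset.sum_congr rfl fun k _ => ?_
  rw [esymmInv, Finset.sum_mul]
  refine Finset.sum_congr rfl fun s hs => ?_
  rw [Finset.prod_mul_distrib, Finset.prod_const, (Finset.mem_powersetCard.mp hs).2, mul_comm]

lemma prod_one_add_sub_prod_one_sub {N : ℕ} (β : Fin N → ℂ) (x : ℂ) :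
    ∏ j, (1 + x * (Complex.exp (-β j))⁻¹) - ∏ j, (1 - x * (Complex.exp (-β j))⁻¹)
      = 2 * ∑ k ∈ (Finset.range (N + 1)).filter Odd, esymmInv β k * x ^ k := by
  have h := prod_one_add_eq_sum_esymmInv β (-x)
  have e : ∀ j, 1 - x * (Complex.exp (-β j))⁻¹ = 1 + -x * (Complex.exp (-β j))⁻¹ := fun j => by ring
  simp only [e]
  rw [h, prod_one_add_eq_sum_esymmInv, ← Finset.sum_sub_distrib, Finset.sum_filter, Finset.mul_sum]
  refine Finset.sum_congr rfl fun k _ => ?_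
  split_ifs with hk
  · rw [hk.neg_pow]
    ring
  · rw [(Nat.not_odd_iff_even.mp hk).neg_pow]
    ring

/-- The relation between one-variable deformed cycles. -/
lemma IsContour.sum_esymmInv_mul_integral_eq_zero {n d : ℕ} (hd : d + 2 = 3 * n)
    {β : Fin (2 * n) → ℂ} {γ : ℝ → ℂ} (h : IsContour β γ)
    {Q : ℂ → ℂ} (hQ : Differentiable ℂ Q) {C : ℝ} (hC : ∀ z, ‖Q z‖ ≤ C * (1 + ‖z‖) ^ d) :
    ∫ t, deriv γ t * (Q (γ t) * kernelProd β (γ t)) *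
      ∑ k ∈ (Finset.range (2 * n + 1)).filter Odd, esymmInv β k * Complex.exp (-γ t) ^ k = 0 := by
  have ht := h.tameCurve
  have h1 := ht.integral_gammaQuot_half_sub_eq_zero hd h.below hQ hC
  have h2 := ht.integral_gammaQuot_eq_zero hd h.above hQ hC
  obtain ⟨c, hc, hγ⟩ := ht.exists_one_add_abs_le
  have hC0 : 0 ≤ C := by
    have := (norm_nonneg _).trans (hC 0)
    simpa using this
  have hint : ∀ k ≤ 2 * n, MeasureTheory.Integrable fun t =>
      deriv γ t * (Q (γ t) * (kernelProd β (γ t) * Complex.exp (-γ t) ^ k)) := by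
    intro k hk
    obtain ⟨C', hC'0, hC'⟩ := h.exists_norm_kernelProd_mul_exp_pow_le hk
    refine ht.integrable (C := C * c ^ d * C') ?_ fun t => ?_
    · exact (hQ.continuous.comp h.continuous).mul
        (h.continuous_kernelProd.mul ((Complex.continuous_exp.comp h.continuous.neg).pow k))
    · rw [norm_mul]
      have hp : 0 < 1 + |t| := by positivity
      calc _ ≤ (C * (c * (1 + |t|)) ^ d) * (C' * ((1 + |t|) ^ (-(3 / 2) : ℝ)) ^ (2 * n)) := by
            gcongr
            · refine (hC _).trans ?_
              gcongr
              exact (hγ t).2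
            · exact hC' t
        _ = C * c ^ d * C' * (((1 + |t|) ^ (-(3 / 2) : ℝ)) ^ (2 * n) * (1 + |t|) ^ d) := by
            rw [mul_pow c]
            ring
        _ = _ := by rw [rpow_neg_three_halves_pow hp hd]
  have hsum : ∀ (a : ℕ → ℂ), MeasureTheory.Integrable fun t =>
      deriv γ t * (Q (γ t) * kernelProd β (γ t)) *
        ∑ k ∈ Finset.range (2 * n + 1), a k * Complex.exp (-γ t) ^ k := by
    intro a
    have := MeasureTheory.integrable_finsetSum (Finset.range (2 * n + 1)) fun k hk =>
      (hint k (by simpa [Nat.lt_succ_iff] using hk)).const_mul (a k)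
    refine this.congr (Filter.Eventually.of_forall fun t => ?_)
    simp only
    rw [Finset.mul_sum]
    refine Finset.sum_congr rfl fun k _ => ?_
    ring
  have hplus : ∀ t, deriv γ t * (Q (γ t) * kernelProd β (γ t)) *
      ∏ j, (1 + Complex.exp (-γ t) * (Complex.exp (-β j))⁻¹)
      = (-2 * Real.pi) ^ (2 * n) * (deriv γ t * (Q (γ t) *
          ∏ j, gammaQuot (1 / 2 - gammaArg (β j) (γ t)))) := by
    intro t
    have : kernelProd β (γ t) * ∏ j, (1 + Complex.exp (-γ t) * (Complex.exp (-β j))⁻¹)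
        = (-2 * Real.pi) ^ (2 * n) * ∏ j, gammaQuot (1 / 2 - gammaArg (β j) (γ t)) := by
      rw [kernelProd, ← Finset.prod_mul_distrib]
      have e : ∀ j, gammaKernel (gammaArg (β j) (γ t)) *
          (1 + Complex.exp (-γ t) * (Complex.exp (-β j))⁻¹)
          = -2 * Real.pi * gammaQuot (1 / 2 - gammaArg (β j) (γ t)) := by
        intro j
        rw [← gammaKernel_mul_one_add (h.gammaArg_ne_half_sub j t), exp_gammaArg]
      simp only [e]
      rw [Finset.prod_mul_distrib, Finset.prod_const, Finset.card_univ, Fintype.card_fin]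
    linear_combination deriv γ t * Q (γ t) * this
  have hminus : ∀ t, deriv γ t * (Q (γ t) * kernelProd β (γ t)) *
      ∏ j, (1 - Complex.exp (-γ t) * (Complex.exp (-β j))⁻¹)
      = (2 * Real.pi * Complex.I) ^ (2 * n) * (deriv γ t * (Q (γ t) *
          ∏ j, gammaQuot (gammaArg (β j) (γ t)))) := by
    intro t
    have : kernelProd β (γ t) * ∏ j, (1 - Complex.exp (-γ t) * (Complex.exp (-β j))⁻¹)
        = (2 * Real.pi * Complex.I) ^ (2 * n) * ∏ j, gammaQuot (gammaArg (β j) (γ t)) := by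
      rw [kernelProd, ← Finset.prod_mul_distrib]
      have e : ∀ j, gammaKernel (gammaArg (β j) (γ t)) *
          (1 - Complex.exp (-γ t) * (Complex.exp (-β j))⁻¹)
          = 2 * Real.pi * Complex.I * gammaQuot (gammaArg (β j) (γ t)) := by
        intro j
        rw [← gammaKernel_mul_one_sub (h.gammaArg_ne_natCast j t), exp_gammaArg]
      simp only [e]
      rw [Finset.prod_mul_distrib, Finset.prod_const, Finset.card_univ, Fintype.card_fin]
    linear_combination deriv γ t * Q (γ t) * this
  have hI1 : MeasureTheory.Integrable fun t => deriv γ t * (Q (γ t) * kernelProd β (γ t)) *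
      ∏ j, (1 + Complex.exp (-γ t) * (Complex.exp (-β j))⁻¹) := by
    simp only [prod_one_add_eq_sum_esymmInv]
    exact hsum _
  have hI2 : MeasureTheory.Integrable fun t => deriv γ t * (Q (γ t) * kernelProd β (γ t)) *
      ∏ j, (1 - Complex.exp (-γ t) * (Complex.exp (-β j))⁻¹) := by
    have e : ∀ t j, 1 - Complex.exp (-γ t) * (Complex.exp (-β j))⁻¹
        = 1 + -Complex.exp (-γ t) * (Complex.exp (-β j))⁻¹ := fun t j => by ring
    simp only [e, prod_one_add_eq_sum_esymmInv, neg_pow (Complex.exp _), ← mul_assoc (esymmInv _ _)]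
    exact hsum _
  -- The first product leaves poles only below the contour and the second only above it, so both
  -- integrals vanish. Even powers of `A` cancel in the difference.
  have key : ∫ t, (deriv γ t * (Q (γ t) * kernelProd β (γ t)) *
        ∏ j, (1 + Complex.exp (-γ t) * (Complex.exp (-β j))⁻¹)
      - deriv γ t * (Q (γ t) * kernelProd β (γ t)) *
        ∏ j, (1 - Complex.exp (-γ t) * (Complex.exp (-β j))⁻¹)) = 0 := by
    rw [MeasureTheory.integral_sub hI1 hI2]
    simp only [hplus, hminus]
    rw [MeasureTheory.integral_const_mul, MeasureTheory.integral_const_mul, h1, h2]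
    simp
  simp only [← mul_sub, prod_one_add_sub_prod_one_sub] at key
  have e : ∀ t, deriv γ t * (Q (γ t) * kernelProd β (γ t)) *
      (2 * ∑ k ∈ (Finset.range (2 * n + 1)).filter Odd, esymmInv β k * Complex.exp (-γ t) ^ k)
      = 2 * (deriv γ t * (Q (γ t) * kernelProd β (γ t)) *
      ∑ k ∈ (Finset.range (2 * n + 1)).filter Odd, esymmInv β k * Complex.exp (-γ t) ^ k) :=
    fun t => by ring
  simp only [e] at key
  rw [MeasureTheory.integral_const_mul] at key
  exact (mul_eq_zero.mp key).resolve_left two_ne_zero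

lemma esymmInv_one {N : ℕ} (β : Fin N → ℂ) : esymmInv β 1 = ∑ j, (Complex.exp (-β j))⁻¹ := by
  rw [esymmInv, Finset.powersetCard_one, Finset.sum_map]
  simp

/-- A subset with `N` of the `N + 1` indices omits a single `j`, and the full product times its
inverses leaves `B_j`. -/
lemma prod_mul_esymmInv_sub_one {N : ℕ} (β : Fin (N + 1) → ℂ) :
    (∏ j, Complex.exp (-β j)) * esymmInv β N = ∑ j, Complex.exp (-β j) := by
  have h : esymmInv β N = ∑ j, ∏ i ∈ {j}ᶜ, (Complex.exp (-β i))⁻¹ := by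
    symm
    refine Finset.sum_bij (fun j _ => {j}ᶜ) (fun j _ => ?_) (fun i _ j _ hij => ?_)
      (fun s hs => ?_) (fun j _ => rfl)
    · simp [Finset.mem_powersetCard, Finset.card_compl]
    · exact Finset.singleton_injective (compl_injective hij)
    · have h1 : sᶜ.card = 1 := by
        simp [Finset.card_compl, (Finset.mem_powersetCard.mp hs).2]
      obtain ⟨a, ha⟩ := Finset.card_eq_one.mp h1
      exact ⟨a, Finset.mem_univ _, by rw [← ha, compl_compl]⟩
  rw [h, Finset.mul_sum]
  refine Finset.sum_congr rfl fun j _ => ?_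
  rw [← Finset.prod_mul_prod_compl {j}, Finset.prod_singleton, mul_assoc, ← Finset.prod_mul_distrib,
    Finset.prod_eq_one, mul_one]
  exact fun i _ => mul_inv_cancel₀ (Complex.exp_ne_zero _)

/-! ### The numerator of `w_S`: antisymmetry and degree. -/

/-- The numerator of `gFn` over the common denominator `∏_a ∏_j (α_a - β_j)`. -/
def gNum {N ℓ : ℕ} (β : Fin N → ℂ) (m : Fin ℓ → Fin N) (α : Fin ℓ → ℂ) : ℂ :=
  (∏ a, ((∏ j ∈ Finset.univ.filter (fun j => j < m a), (α a - β j + Real.pi * Complex.I))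
      * ∏ j ∈ Finset.univ.filter (fun j => m a < j), (α a - β j)))
    * ∏ p ∈ (Finset.univ : Finset (Fin ℓ × Fin ℓ)).filter (fun p => p.1 < p.2),
        (α p.1 - α p.2 + Real.pi * Complex.I)

/-- The numerator of `wM` over the common denominator `∏_a ∏_j (α_a - β_j)`. -/
def wNum {N ℓ : ℕ} (β : Fin N → ℂ) (S : {S : Finset (Fin N) // S.card = ℓ}) :
    (Fin ℓ → ℂ) → ℂ :=
  asym (gNum β (fun a => S.1.orderEmbOfFin S.2 a))

lemma prod_eq_mul_prod_lt_mul_prod_gt {N : ℕ} (f : Fin N → ℂ) (i : Fin N) :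
    ∏ j, f j = f i * (∏ j ∈ Finset.univ.filter (fun j => j < i), f j)
      * ∏ j ∈ Finset.univ.filter (fun j => i < j), f j := by
  rw [← Finset.prod_filter_mul_prod_filter_not Finset.univ (fun j => j < i)]
  have h : Finset.univ.filter (fun j => ¬ j < i)
      = insert i (Finset.univ.filter (fun j => i < j)) := by
    ext j
    simp only [Finset.mem_filter, Finset.mem_univ, true_and, Finset.mem_insert, not_lt]
    rw [le_iff_eq_or_lt, eq_comm]
  rw [h, Finset.prod_insert (by simp)]
  ring

lemma gFn_eq_gNum_div {N ℓ : ℕ} {β : Fin N → ℂ} (m : Fin ℓ → Fin N) {α : Fin ℓ → ℂ}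
    (h : ∀ a j, α a - β j ≠ 0) :
    gFn β m α = gNum β m α / ∏ a, ∏ j, (α a - β j) := by
  unfold gFn gNum
  rw [mul_div_right_comm, ← Finset.prod_div_distrib]
  congr 1
  refine Finset.prod_congr rfl fun a _ => ?_
  rw [prod_eq_mul_prod_lt_mul_prod_gt _ (m a), Finset.prod_div_distrib]
  have h1 := h a (m a)
  have h2 : ∏ j ∈ Finset.univ.filter (fun j => j < m a), (α a - β j) ≠ 0 :=
    Finset.prod_ne_zero_iff.mpr fun j _ => h a j
  have h3 : ∏ j ∈ Finset.univ.filter (fun j => m a < j), (α a - β j) ≠ 0 :=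
    Finset.prod_ne_zero_iff.mpr fun j _ => h a j
  field_simp

/-- The common denominator is symmetric in the `α_a`, so antisymmetrization acts on the numerator
alone. -/
lemma wM_eq_wNum_div {N ℓ : ℕ} {β : Fin N → ℂ} (S : {S : Finset (Fin N) // S.card = ℓ})
    {α : Fin ℓ → ℂ} (h : ∀ a j, α a - β j ≠ 0) :
    wM β S α = wNum β S α / ∏ a, ∏ j, (α a - β j) := by
  unfold wM wNum asym
  rw [Finset.sum_div]
  refine Finset.sum_congr rfl fun σ _ => ?_
  rw [gFn_eq_gNum_div _ (α := α ∘ σ) fun a j => h (σ a) j, mul_div_assoc]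
  congr 2
  exact Equiv.prod_comp σ fun a => ∏ j, (α a - β j)

lemma asym_comp_perm {ℓ : ℕ} (f : (Fin ℓ → ℂ) → ℂ) (α : Fin ℓ → ℂ) (τ : Equiv.Perm (Fin ℓ)) :
    asym f (α ∘ τ) = ((Equiv.Perm.sign τ : ℤ) : ℂ) * asym f α := by
  unfold asym
  rw [Finset.mul_sum, ← Equiv.sum_comp (Equiv.mulLeft τ)
    (fun σ => ((Equiv.Perm.sign τ : ℤ) : ℂ) * (((Equiv.Perm.sign σ : ℤ) : ℂ) * f (α ∘ σ)))]
  refine Finset.sum_congr rfl fun σ _ => ?_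
  have h : ((Equiv.Perm.sign τ : ℤ) : ℂ) * ((Equiv.Perm.sign τ : ℤ) : ℂ) = 1 := by
    rw [← Int.cast_mul, Int.units_coe_mul_self, Int.cast_one]
  simp only [Equiv.coe_mulLeft, Equiv.Perm.sign_mul, Units.val_mul, Int.cast_mul, Equiv.Perm.coe_mul]
  rw [← Function.comp_assoc]
  linear_combination -((Equiv.Perm.sign σ : ℤ) : ℂ) * f ((α ∘ τ) ∘ σ) * h

lemma differentiable_finsetProd {E ι : Type*} [NormedAddCommGroup E] [NormedSpace ℂ E]
    {s : Finset ι} {f : ι → E → ℂ} (hf : ∀ i ∈ s, Differentiable ℂ (f i)) :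
    Differentiable ℂ fun x => ∏ i ∈ s, f i x := fun x => by
  classical
  exact (HasFDerivAt.finsetProd fun i hi => (hf i hi x).hasFDerivAt).differentiableAt

lemma differentiable_gNum {N ℓ : ℕ} (β : Fin N → ℂ) (m : Fin ℓ → Fin N) :
    Differentiable ℂ (gNum β m) := by
  unfold gNum
  refine Differentiable.mul (differentiable_finsetProd fun a _ => ?_) ?_
  · refine Differentiable.mul ?_ ?_ <;>
      exact differentiable_finsetProd fun j _ => by fun_prop
  · exact differentiable_finsetProd (f := fun (p : Fin ℓ × Fin ℓ) (α : Fin ℓ → ℂ) =>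
      α p.1 - α p.2 + Real.pi * Complex.I) fun p _ => by fun_prop

lemma differentiable_wNum {N ℓ : ℕ} (β : Fin N → ℂ) (S : {S : Finset (Fin N) // S.card = ℓ}) :
    Differentiable ℂ (wNum β S) := by
  unfold wNum asym
  refine Differentiable.fun_sum fun σ _ => Differentiable.const_mul ?_ _
  refine (differentiable_gNum β _).comp (g := gNum β _) (f := fun α : Fin ℓ → ℂ => α ∘ σ) ?_
  exact differentiable_pi.mpr fun a => differentiable_apply (σ a)

lemma prod_pairs_mul {ℓ : ℕ} (x : Fin ℓ → ℝ) :
    ∏ p ∈ (Finset.univ : Finset (Fin ℓ × Fin ℓ)).filter (fun p => p.1 < p.2), (x p.1 * x p.2)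
      = ∏ a, x a ^ (ℓ - 1) := by
  have h1 : ∏ p ∈ (Finset.univ : Finset (Fin ℓ × Fin ℓ)).filter (fun p => p.1 < p.2), x p.2
      = ∏ p ∈ (Finset.univ : Finset (Fin ℓ × Fin ℓ)).filter (fun p => p.2 < p.1), x p.1 := by
    refine Finset.prod_nbij' Prod.swap Prod.swap ?_ ?_ ?_ ?_ ?_ <;> simp
  have hd : Disjoint (Finset.univ.filter (fun p : Fin ℓ × Fin ℓ => p.1 < p.2))
      (Finset.univ.filter (fun p : Fin ℓ × Fin ℓ => p.2 < p.1)) :=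
    Finset.disjoint_filter.mpr fun _ _ h => h.asymm
  have h2 : (Finset.univ : Finset (Fin ℓ × Fin ℓ)).filter (fun p => p.1 ≠ p.2)
      = (Finset.univ.filter (fun p : Fin ℓ × Fin ℓ => p.1 < p.2)).disjUnion
        (Finset.univ.filter (fun p : Fin ℓ × Fin ℓ => p.2 < p.1))
        hd := by
    ext p
    simp
  rw [Finset.prod_mul_distrib, h1, ← Finset.prod_disjUnion hd, ← h2, Finset.prod_filter,
    ← Finset.univ_product_univ, Finset.prod_product]
  refine Finset.prod_congr rfl fun a _ => ?_
  rw [← Finset.prod_filter]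
  refine (Finset.prod_const (x a)).trans ?_
  congr 1
  have : Finset.univ.filter (fun b => (a, b).1 ≠ (a, b).2) = Finset.univ.erase a := by
    ext b
    simp [eq_comm]
  rw [this, Finset.card_erase_of_mem (Finset.mem_univ _), Finset.card_univ, Fintype.card_fin]

/-- In each variable the product over rapidities has degree `N - 1`, as `j = m_a` is omitted, and
the product over pairs has degree `ℓ - 1`. For `N = 2n`, `ℓ = n` the total is `3n - 2`, the largest
degree that leaves quadratic decay. -/
lemma exists_norm_gNum_le {N ℓ : ℕ} (β : Fin N → ℂ) (m : Fin ℓ → Fin N) :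
    ∃ C : ℝ, 0 ≤ C ∧ ∀ α, ‖gNum β m α‖ ≤ C * ∏ a, (1 + ‖α a‖) ^ (N - 1 + (ℓ - 1)) := by
  have hpi := Real.pi_pos
  let c : ℝ := 1 + Real.pi + ∑ j, ‖β j‖
  have hc0 : 0 ≤ ∑ j, ‖β j‖ := Finset.sum_nonneg fun j _ => norm_nonneg _
  have hcβ : ∀ j, ‖β j‖ ≤ ∑ j, ‖β j‖ := fun j =>
    Finset.single_le_sum (f := fun j => ‖β j‖) (fun j _ => norm_nonneg _) (Finset.mem_univ j)
  have hpiI : ‖(Real.pi * Complex.I : ℂ)‖ = Real.pi := by simp [abs_of_pos hpi]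
  have hc : 0 ≤ c := by simp only [c]; linarith
  have hmul : ∀ x : ℝ, 0 ≤ x → x + Real.pi + ∑ j, ‖β j‖ ≤ c * (1 + x) := by
    intro x hx
    simp only [c]
    nlinarith [mul_nonneg hc0 hx, mul_nonneg hpi.le hx]
  have h1 : ∀ (z : ℂ) j, ‖z - β j + Real.pi * Complex.I‖ ≤ c * (1 + ‖z‖) := by
    intro z j
    have h1 := norm_add_le (z - β j) (Real.pi * Complex.I)
    have h2 := norm_sub_le z (β j)
    rw [hpiI] at h1
    linarith [hmul _ (norm_nonneg z), hcβ j]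
  have h2 : ∀ (z : ℂ) j, ‖z - β j‖ ≤ c * (1 + ‖z‖) := by
    intro z j
    have h2 := norm_sub_le z (β j)
    linarith [hmul _ (norm_nonneg z), hcβ j]
  have h3 : ∀ z w : ℂ, ‖z - w + Real.pi * Complex.I‖ ≤ c * ((1 + ‖z‖) * (1 + ‖w‖)) := by
    intro z w
    have h1 := norm_add_le (z - w) (Real.pi * Complex.I)
    have h2 := norm_sub_le z w
    rw [hpiI] at h1
    have h3 := hmul _ (add_nonneg (norm_nonneg z) (norm_nonneg w))
    have h4 : 1 + (‖z‖ + ‖w‖) ≤ (1 + ‖z‖) * (1 + ‖w‖) := by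
      nlinarith [mul_nonneg (norm_nonneg z) (norm_nonneg w)]
    have h5 := mul_le_mul_of_nonneg_left h4 hc
    linarith
  refine ⟨(∏ _a : Fin ℓ, c ^ (N - 1)) *
    ∏ _p ∈ (Finset.univ : Finset (Fin ℓ × Fin ℓ)).filter (fun p => p.1 < p.2), c, by positivity,
    fun α => ?_⟩
  unfold gNum
  rw [norm_mul, norm_prod, norm_prod]
  have h4 : ∀ a, ‖(∏ j ∈ Finset.univ.filter (fun j => j < m a), (α a - β j + Real.pi * Complex.I))
      * ∏ j ∈ Finset.univ.filter (fun j => m a < j), (α a - β j)‖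
      ≤ c ^ (N - 1) * (1 + ‖α a‖) ^ (N - 1) := by
    intro a
    rw [norm_mul, norm_prod, norm_prod]
    have hcard : (Finset.univ.filter (fun j => j < m a)).card
        + (Finset.univ.filter (fun j => m a < j)).card = N - 1 := by
      have e1 : Finset.univ.filter (fun j => j < m a) = Finset.Iio (m a) := by ext; simp
      have e2 : Finset.univ.filter (fun j => m a < j) = Finset.Ioi (m a) := by ext; simp
      rw [e1, e2, Fin.card_Iio, Fin.card_Ioi]
      have := (m a).isLt
      omega
    calc _ ≤ (∏ _j ∈ Finset.univ.filter (fun j => j < m a), c * (1 + ‖α a‖))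
          * ∏ _j ∈ Finset.univ.filter (fun j => m a < j), c * (1 + ‖α a‖) := by
          gcongr
          · exact h1 _ _
          · exact h2 _ _
      _ = _ := by rw [Finset.prod_const, Finset.prod_const, ← pow_add, hcard, mul_pow]
  calc _ ≤ (∏ a, c ^ (N - 1) * (1 + ‖α a‖) ^ (N - 1))
        * ∏ p ∈ (Finset.univ : Finset (Fin ℓ × Fin ℓ)).filter (fun p => p.1 < p.2),
          c * ((1 + ‖α p.1‖) * (1 + ‖α p.2‖)) := by
        gcongr
        · exact h4 _
        · exact h3 _ _
    _ = _ := by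
        rw [Finset.prod_mul_distrib, Finset.prod_mul_distrib, prod_pairs_mul fun a => 1 + ‖α a‖]
        simp only [pow_add]
        rw [Finset.prod_mul_distrib]
        ring

lemma exists_norm_wNum_le {N ℓ : ℕ} (β : Fin N → ℂ) (S : {S : Finset (Fin N) // S.card = ℓ}) :
    ∃ C : ℝ, 0 ≤ C ∧ ∀ α, ‖wNum β S α‖ ≤ C * ∏ a, (1 + ‖α a‖) ^ (N - 1 + (ℓ - 1)) := by
  obtain ⟨C, hC0, hC⟩ := exists_norm_gNum_le β (fun a => S.1.orderEmbOfFin S.2 a)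
  refine ⟨∑ _σ : Equiv.Perm (Fin ℓ), C, by positivity, fun α => ?_⟩
  unfold wNum asym
  rw [Finset.sum_mul]
  refine norm_sum_le_of_le _ fun σ _ => ?_
  rw [norm_mul]
  have h1 : ‖((Equiv.Perm.sign σ : ℤ) : ℂ)‖ = 1 := by
    rcases Int.units_eq_one_or (Equiv.Perm.sign σ) with h | h <;> simp [h]
  rw [h1, one_mul]
  refine (hC _).trans (le_of_eq ?_)
  congr 1
  exact Equiv.prod_comp σ fun a => (1 + ‖α a‖) ^ (N - 1 + (ℓ - 1))

/-! ### Multiple integrals and the relation between the two monomials. -/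

/-- The regularized integrand attached to the monomial `∏_a A_a^{k_a}`. -/
def cycleIntegrand {N ℓ : ℕ} (γ : ℝ → ℂ) (β : Fin N → ℂ)
    (S : {S : Finset (Fin N) // S.card = ℓ}) (k : Fin ℓ → ℕ) (t : Fin ℓ → ℝ) : ℂ :=
  (∏ a, deriv γ (t a)) * ((∏ a, kernelProd β (γ (t a))) * wNum β S (fun a => γ (t a))
    * ∏ a, Complex.exp (-γ (t a)) ^ k a)

/-- The integral attached to the monomial `∏_a A_a^{k_a}`. -/
def cycleIntegral {N ℓ : ℕ} (γ : ℝ → ℂ) (β : Fin N → ℂ)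
    (S : {S : Finset (Fin N) // S.card = ℓ}) (k : Fin ℓ → ℕ) : ℂ :=
  ∫ t, cycleIntegrand γ β S k t

lemma ae_forall_apply {ℓ : ℕ} {p : ℝ → Prop} (h : ∀ᵐ s : ℝ, p s) :
    ∀ᵐ t : Fin ℓ → ℝ, ∀ a, p (t a) := by
  rw [MeasureTheory.ae_all_iff]
  intro a
  exact (MeasureTheory.Measure.tendsto_eval_ae_ae (i := a)).eventually h

/-- The polynomial bound on `wNum` is a product over the variables, so the integrand is dominated by
a product of functions `(1 + |t_a|)^{-2}`. -/
lemma IsContour.integrable_cycleIntegrand {n : ℕ} (hn : 1 ≤ n) {β : Fin (2 * n) → ℂ} {γ : ℝ → ℂ}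
    (h : IsContour β γ) (S : {S : Finset (Fin (2 * n)) // S.card = n}) {k : Fin n → ℕ}
    (hk : ∀ a, k a ≤ 2 * n) : MeasureTheory.Integrable (cycleIntegrand γ β S k) := by
  have ht := h.tameCurve
  obtain ⟨K, hK0, hK⟩ := ht.ae_norm_deriv_le
  choose C hC0 hC using fun a => h.exists_norm_kernelProd_mul_exp_pow_le (hk a)
  obtain ⟨c, hc, hγ⟩ := ht.exists_one_add_abs_le
  obtain ⟨D, hD0, hD⟩ := exists_norm_wNum_le β S
  have hd : (2 * n - 1 + (n - 1)) + 2 = 3 * n := by omega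
  generalize 2 * n - 1 + (n - 1) = d at hd hD
  have hb : MeasureTheory.Integrable fun t : Fin n → ℝ =>
      D * ∏ a, K * C a * c ^ d * (1 + |t a|) ^ (-2 : ℝ) :=
    (MeasureTheory.Integrable.fintype_prod
      (f := fun a (s : ℝ) => K * C a * c ^ d * (1 + |s|) ^ (-2 : ℝ)) fun a =>
      integrable_one_add_abs_rpow_neg_two.const_mul _).const_mul D
  refine hb.mono' ?_ ?_
  · unfold cycleIntegrand
    have h1 : Measurable fun t : Fin n → ℝ => ∏ a, deriv γ (t a) :=
      Finset.measurable_fun_prod _ fun a _ => (measurable_deriv γ).comp (measurable_pi_apply a)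
    have h2 : Continuous fun t : Fin n → ℝ => (∏ a, kernelProd β (γ (t a)))
        * wNum β S (fun a => γ (t a)) * ∏ a, Complex.exp (-γ (t a)) ^ k a := by
      refine ((continuous_finsetProd _ fun a _ => ?_).mul ?_).mul
        (continuous_finsetProd _ fun a _ => ?_)
      · exact h.continuous_kernelProd.comp (continuous_apply a)
      · exact (differentiable_wNum β S).continuous.comp
          (continuous_pi fun a => h.continuous.comp (continuous_apply a))
      · exact (Complex.continuous_exp.comp (h.continuous.comp (continuous_apply a)).neg).pow _
    exact h1.aestronglyMeasurable.mul h2.aestronglyMeasurable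
  · filter_upwards [ae_forall_apply hK] with t htK
    have e : cycleIntegrand γ β S k t = (∏ a, deriv γ (t a)
        * (kernelProd β (γ (t a)) * Complex.exp (-γ (t a)) ^ k a))
        * wNum β S (fun a => γ (t a)) := by
      rw [cycleIntegrand, Finset.prod_mul_distrib, Finset.prod_mul_distrib]
      ring
    rw [e, norm_mul, norm_prod]
    calc _ ≤ (∏ a, K * (C a * ((1 + |t a|) ^ (-(3 / 2) : ℝ)) ^ (2 * n)))
          * (D * ∏ a, (c * (1 + |t a|)) ^ d) := by
          gcongr with a _
          · refine Finset.prod_nonneg fun a _ => ?_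
            have := hC0 a
            positivity
          · rw [norm_mul]
            have := hC a (t a)
            have := htK a
            gcongr
          · refine (hD _).trans ?_
            gcongr
            exact (hγ _).2
      _ = D * ∏ a, K * C a * c ^ d * (((1 + |t a|) ^ (-(3 / 2) : ℝ)) ^ (2 * n) * (1 + |t a|) ^ d) := by
          rw [mul_left_comm, ← Finset.prod_mul_distrib]
          congr 1
          refine Finset.prod_congr rfl fun a _ => ?_
          rw [mul_pow c]
          ring
      _ = _ := by
          congr 1
          refine Finset.prod_congr rfl fun a _ => ?_
          rw [rpow_neg_three_halves_pow (by positivity) hd]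

/-- Relabelling the variables preserves the measure and every factor except the antisymmetric
`wNum`, which produces the sign. -/
lemma cycleIntegral_comp_perm {N ℓ : ℕ} (γ : ℝ → ℂ) (β : Fin N → ℂ)
    (S : {S : Finset (Fin N) // S.card = ℓ}) (k : Fin ℓ → ℕ) (σ : Equiv.Perm (Fin ℓ)) :
    cycleIntegral γ β S (k ∘ σ) = ((Equiv.Perm.sign σ : ℤ) : ℂ) * cycleIntegral γ β S k := by
  have hmp := MeasureTheory.volume_measurePreserving_piCongrLeft (fun _ : Fin ℓ => ℝ) σ
  unfold cycleIntegral
  rw [← hmp.integral_comp (MeasurableEquiv.measurableEmbedding _) (cycleIntegrand γ β S k),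
    ← MeasureTheory.integral_const_mul]
  congr 1
  ext t
  have ht : ∀ a, MeasurableEquiv.piCongrLeft (fun _ : Fin ℓ => ℝ) σ t (σ a) = t a := fun a => by
    rw [MeasurableEquiv.coe_piCongrLeft, Equiv.piCongrLeft_apply_apply]
  generalize MeasurableEquiv.piCongrLeft (fun _ : Fin ℓ => ℝ) σ t = u at ht
  unfold cycleIntegrand
  have h1 : ∏ a, deriv γ (t a) = ∏ a, deriv γ (u a) := by
    rw [← Equiv.prod_comp σ (fun a => deriv γ (u a))]
    simp only [ht]
  have h2 : ∏ a, kernelProd β (γ (t a)) = ∏ a, kernelProd β (γ (u a)) := by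
    rw [← Equiv.prod_comp σ (fun a => kernelProd β (γ (u a)))]
    simp only [ht]
  have h3 : ∏ a, Complex.exp (-γ (t a)) ^ (k ∘ σ) a = ∏ a, Complex.exp (-γ (u a)) ^ k a := by
    rw [← Equiv.prod_comp σ (fun a => Complex.exp (-γ (u a)) ^ k a)]
    simp only [ht, Function.comp_apply]
  have h4 : wNum β S (fun a => γ (t a))
      = ((Equiv.Perm.sign σ : ℤ) : ℂ) * wNum β S (fun a => γ (u a)) := by
    have : (fun a => γ (t a)) = (fun a => γ (u a)) ∘ σ := by
      ext a
      simp only [Function.comp_apply, ht]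
    rw [this]
    exact asym_comp_perm _ _ σ
  rw [h1, h2, h3, h4]
  ring

lemma cycleIntegral_eq_zero_of_eq {N ℓ : ℕ} (γ : ℝ → ℂ) (β : Fin N → ℂ)
    (S : {S : Finset (Fin N) // S.card = ℓ}) {k : Fin ℓ → ℕ} {a b : Fin ℓ} (hab : a ≠ b)
    (h : k a = k b) : cycleIntegral γ β S k = 0 := by
  have h1 := cycleIntegral_comp_perm γ β S k (Equiv.swap a b)
  have h2 : k ∘ Equiv.swap a b = k := by
    ext c
    simp only [Function.comp_apply, Equiv.swap_apply_def]
    split_ifs with ha hb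
    · rw [ha, h]
    · rw [hb, h]
    · rfl
  rw [h2, Equiv.Perm.sign_swap hab] at h1
  simp only [Units.val_neg, Units.val_one, Int.cast_neg, Int.cast_one, neg_mul, one_mul] at h1
  linear_combination h1 / 2

/-- The relation between deformed cycles which differ in the first variable. -/
lemma IsContour.sum_esymmInv_mul_cycleIntegral_eq_zero {n : ℕ} {β : Fin (2 * (n + 1)) → ℂ}
    {γ : ℝ → ℂ} (h : IsContour β γ)
    (S : {S : Finset (Fin (2 * (n + 1))) // S.card = n + 1}) {k : Fin (n + 1) → ℕ}
    (hk : ∀ a, k a ≤ 2 * (n + 1)) :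
    ∑ j ∈ (Finset.range (2 * (n + 1) + 1)).filter Odd,
      esymmInv β j * cycleIntegral γ β S (Function.update k 0 j) = 0 := by
  have hupd : ∀ j ∈ (Finset.range (2 * (n + 1) + 1)).filter Odd, ∀ a,
      Function.update k 0 j a ≤ 2 * (n + 1) := by
    intro j hj a
    rw [Finset.mem_filter, Finset.mem_range] at hj
    rcases eq_or_ne a 0 with rfl | ha
    · rw [Function.update_self]
      omega
    · rw [Function.update_of_ne ha]
      exact hk a
  have hint : ∀ j ∈ (Finset.range (2 * (n + 1) + 1)).filter Odd,
      MeasureTheory.Integrable fun t =>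
        esymmInv β j * cycleIntegrand γ β S (Function.update k 0 j) t := fun j hj =>
    (h.integrable_cycleIntegrand (by omega) S (hupd j hj)).const_mul _
  simp only [cycleIntegral, ← MeasureTheory.integral_const_mul]
  rw [← MeasureTheory.integral_finsetSum _ hint]
  have hG := MeasureTheory.integrable_finsetSum _ hint
  have hmp := (MeasureTheory.volume_preserving_piFinSuccAbove (fun _ : Fin (n + 1) => ℝ) 0).symm
  have hG' := (hmp.integrable_comp_emb (MeasurableEquiv.measurableEmbedding _)).mpr hG
  rw [← hmp.integral_comp (MeasurableEquiv.measurableEmbedding _)]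
  rw [MeasureTheory.Measure.volume_eq_prod] at hG' ⊢
  -- Fubini with the first variable innermost: the one-variable relation makes the inner integral
  -- vanish for every value of the other variables.
  refine (MeasureTheory.integral_prod_symm _ hG').trans ?_
  have hin : ∀ y : Fin n → ℝ, ∫ x : ℝ, (∑ j ∈ (Finset.range (2 * (n + 1) + 1)).filter Odd,
      esymmInv β j * cycleIntegrand γ β S (Function.update k 0 j)
        (Fin.cons x y : Fin (n + 1) → ℝ)) = 0 := by
    intro y
    obtain ⟨D, hD0, hD⟩ := exists_norm_wNum_le β S
    -- The polynomial `Q` is the numerator of `w_S` in its first variable, the others being frozen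
    -- at points of the contour.
    have hrel := h.sum_esymmInv_mul_integral_eq_zero
      (d := 2 * (n + 1) - 1 + (n + 1 - 1)) (by omega)
      (Q := fun z => wNum β S (Fin.cons z fun a => γ (y a)))
      ((differentiable_wNum β S).comp (f := fun z : ℂ =>
        (Fin.cons z fun a => γ (y a) : Fin (n + 1) → ℂ)) (differentiable_pi.mpr fun a => by
          refine Fin.cases ?_ (fun b => ?_) a
          · simp only [Fin.cons_zero]
            exact differentiable_id
          · simp only [Fin.cons_succ]
            exact differentiable_const _))
      (C := D * ∏ a : Fin n, (1 + ‖γ (y a)‖) ^ (2 * (n + 1) - 1 + (n + 1 - 1)))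
      (fun z => by
        refine (hD _).trans (le_of_eq ?_)
        rw [Fin.prod_univ_succ]
        simp only [Fin.cons_zero, Fin.cons_succ]
        ring)
    have e : ∀ x : ℝ, (∑ j ∈ (Finset.range (2 * (n + 1) + 1)).filter Odd,
        esymmInv β j * cycleIntegrand γ β S (Function.update k 0 j)
          (Fin.cons x y : Fin (n + 1) → ℝ))
        = ((∏ a, deriv γ (y a)) * (∏ a, kernelProd β (γ (y a)))
            * ∏ a : Fin n, Complex.exp (-γ (y a)) ^ k a.succ)
          * (deriv γ x * (wNum β S (Fin.cons (γ x) fun a => γ (y a)) * kernelProd β (γ x)) *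
            ∑ j ∈ (Finset.range (2 * (n + 1) + 1)).filter Odd,
              esymmInv β j * Complex.exp (-γ x) ^ j) := by
      intro x
      rw [Finset.mul_sum, Finset.mul_sum]
      refine Finset.sum_congr rfl fun j _ => ?_
      have hcons : (fun a => γ ((Fin.cons x y : Fin (n + 1) → ℝ) a))
          = (Fin.cons (γ x) fun a => γ (y a) : Fin (n + 1) → ℂ) := by
        ext a
        refine Fin.cases ?_ (fun b => ?_) a <;> simp
      rw [cycleIntegrand, hcons, Fin.prod_univ_succ, Fin.prod_univ_succ, Fin.prod_univ_succ]
      simp only [Fin.cons_zero, Fin.cons_succ, Function.update_self,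
        Function.update_of_ne (Fin.succ_ne_zero _)]
      ring
    simp only [e]
    rw [MeasureTheory.integral_const_mul, hrel, mul_zero]
  rw [← MeasureTheory.integral_zero (Fin n → ℝ) ℂ (μ := MeasureTheory.volume)]
  congr 1
  ext y
  rw [← hin y]
  congr 1
  ext x
  refine Finset.sum_congr rfl fun j _ => ?_
  congr 2
  exact Fin.insertNth_zero' x y

/-- The exponents of the monomial `∏_{a<n} A_a^{2a-1}`. -/
def lowExponents (n : ℕ) (a : Fin n) : ℕ := if (a : ℕ) + 1 < n then 2 * (a : ℕ) + 1 else 0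

/-- The exponents of the monomial `∏_{a<n} A_a^{2a+1}`. -/
def highExponents (n : ℕ) (a : Fin n) : ℕ := if (a : ℕ) + 1 < n then 2 * (a : ℕ) + 3 else 0

lemma lowExponents_le {n : ℕ} (a : Fin n) : lowExponents n a ≤ 2 * n := by
  unfold lowExponents
  split_ifs <;> omega

lemma highExponents_le {n : ℕ} (a : Fin n) : highExponents n a ≤ 2 * n := by
  unfold highExponents
  split_ifs <;> omega

/-- Putting the top exponent `2n + 3` in the first place of the low monomial and rotating the first
`n + 1` places yields the high monomial. The rotation has sign `(-1)^n`, and the last variable, of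
exponent `0`, stays fixed. -/
lemma highExponents_eq_comp (n : ℕ) : highExponents (n + 2)
    = Function.update (lowExponents (n + 2)) 0 (2 * n + 3)
      ∘ Fin.cycleRange (⟨n, by omega⟩ : Fin (n + 2)) := by
  ext a
  rw [Function.comp_apply]
  rcases lt_trichotomy a (⟨n, by omega⟩ : Fin (n + 2)) with ha | ha | ha
  · have hv : ((a + 1 : Fin (n + 2)) : ℕ) = a + 1 := by
      rw [Fin.val_add_one_of_lt]
      exact lt_trans ha (by rw [Fin.lt_def]; simp)
    have ha' : (a : ℕ) < n := ha
    rw [Fin.cycleRange_of_lt ha, Function.update_of_ne (fun h0 => by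
      have := congrArg Fin.val h0
      rw [hv] at this
      simp at this), lowExponents, highExponents, hv, if_pos (by omega), if_pos (by omega)]
    omega
  · subst ha
    rw [Fin.cycleRange_of_eq rfl, Function.update_self, highExponents, if_pos (by simp)]
  · have ha' : n < (a : ℕ) := ha
    rw [Fin.cycleRange_of_gt ha, Function.update_of_ne (fun h0 => by
      rw [h0] at ha'
      simp at ha'), lowExponents, highExponents, if_neg (by omega), if_neg (by omega)]

/-- The two monomials occurring in the cycles of the energy-momentum tensor are related. -/
lemma IsContour.cycleIntegral_relation {n : ℕ} (hn : 1 ≤ n) {β : Fin (2 * n) → ℂ} {γ : ℝ → ℂ}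
    (h : IsContour β γ) (S : {S : Finset (Fin (2 * n)) // S.card = n}) :
    (-1) ^ n * (∑ j, (Complex.exp (-β j))⁻¹) * (∏ j, Complex.exp (-β j))
        * cycleIntegral γ β S (lowExponents n)
      + (∑ j, Complex.exp (-β j)) * cycleIntegral γ β S (highExponents n) = 0 := by
  obtain ⟨n, rfl⟩ : ∃ m, n = m + 1 := ⟨n - 1, by omega⟩
  have hq : (∏ j, Complex.exp (-β j)) * esymmInv β (2 * n + 1) = ∑ j, Complex.exp (-β j) :=
    prod_mul_esymmInv_sub_one (N := 2 * n + 1) β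
  rw [← hq, ← esymmInv_one]
  -- For two particles both monomials are `1`, and the relation is the identity `B₁B₂ (B₁⁻¹ + B₂⁻¹)
  -- = B₁ + B₂`.
  rcases Nat.eq_zero_or_pos n with rfl | hn0
  · have : lowExponents (0 + 1) = highExponents (0 + 1) := by
      ext a
      simp [lowExponents, highExponents]
    rw [this]
    ring
  obtain ⟨n, rfl⟩ : ∃ m, n = m + 1 := ⟨n - 1, by omega⟩
  have hrel := h.sum_esymmInv_mul_cycleIntegral_eq_zero S (k := lowExponents (n + 2))
    lowExponents_le
  have h1 : Function.update (lowExponents (n + 2)) 0 1 = lowExponents (n + 2) := by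
    rw [Function.update_eq_self_iff]
    simp [lowExponents]
  have hsub : ({1, 2 * n + 3} : Finset ℕ)
      ⊆ (Finset.range (2 * (n + 1 + 1) + 1)).filter Odd := by
    intro j hj
    rw [Finset.mem_insert, Finset.mem_singleton] at hj
    rw [Finset.mem_filter, Finset.mem_range]
    rcases hj with rfl | rfl
    · exact ⟨by omega, odd_one⟩
    · exact ⟨by omega, ⟨n + 1, by ring⟩⟩
  -- Every other odd `j` is `2m + 1` with `0 < m ≤ n`, already the exponent of the variable of index
  -- `m`, so antisymmetry kills the term.
  rw [← Finset.sum_subset hsub (fun j hj hj' => by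
    rw [Finset.mem_filter, Finset.mem_range] at hj
    rw [Finset.mem_insert, Finset.mem_singleton, not_or] at hj'
    obtain ⟨hj1, m, rfl⟩ := hj
    have hm : m < n + 2 := by omega
    have hm0 : (⟨m, hm⟩ : Fin (n + 2)) ≠ 0 := fun h0 => by
      have := congrArg Fin.val h0
      simp at this
      omega
    rw [cycleIntegral_eq_zero_of_eq γ β S (a := 0) (b := ⟨m, hm⟩) hm0.symm, mul_zero]
    rw [Function.update_self, Function.update_of_ne hm0, lowExponents, if_pos (by simp; omega)]),
    Finset.sum_pair (by omega), h1] at hrel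
  have h2 := cycleIntegral_comp_perm γ β S (Function.update (lowExponents (n + 2)) 0 (2 * n + 3))
    (Fin.cycleRange (⟨n, by omega⟩ : Fin (n + 2)))
  rw [← highExponents_eq_comp, Fin.sign_cycleRange] at h2
  push_cast at h2
  have h3 : ((-1 : ℂ) ^ n) * (-1) ^ n = 1 := by
    rw [← mul_pow]
    simp
  rw [h2]
  have e : 2 * (n + 1) + 1 = 2 * n + 3 := by ring
  rw [e]
  linear_combination (-1 : ℂ) ^ n * (∏ j, Complex.exp (-β j)) * hrel

/-! ### Return to the integrals defining `Ψ_P`, and the conclusion. -/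

/-- The contour may pass through points `β_j + 2πik` with `k ≥ 1`, where a denominator `1 - A B_j⁻¹`
vanishes and the original integrand takes default values. A simple curve meets each of these
countably many points at most once, so they do not affect the integrals. -/
lemma IsContour.ae_gammaArg_ne_intCast {N : ℕ} {β : Fin N → ℂ} {γ : ℝ → ℂ} (h : IsContour β γ) :
    ∀ᵐ s : ℝ, ∀ (j : Fin N) (k : ℤ), gammaArg (β j) (γ s) ≠ k := by
  rw [MeasureTheory.ae_all_iff]
  intro j
  rw [MeasureTheory.ae_all_iff]
  intro k
  have hs : {s : ℝ | gammaArg (β j) (γ s) = k}.Subsingleton := by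
    intro s hs t ht
    apply h.simple
    rw [Set.mem_ofPred_eq, gammaArg_eq_iff] at hs ht
    rw [hs, ht]
  filter_upwards [MeasureTheory.compl_mem_ae_iff.mpr (hs.countable.measure_zero _)] with s hs'
  exact hs'

lemma phi_div_eq_kernelProd {N : ℕ} {β : Fin N → ℂ} {α : ℂ}
    (h : ∀ (j : Fin N) (k : ℤ), gammaArg (β j) α ≠ k) :
    phi β α / (∏ j, (α - β j)) / ∏ j, (1 - Complex.exp (-α) * (Complex.exp (-β j))⁻¹)
      = kernelProd β α / (4 * Real.pi ^ 2) ^ N := by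
  have e : (4 * Real.pi ^ 2 : ℂ) ^ N = ∏ _j : Fin N, (4 * Real.pi ^ 2 : ℂ) := by simp
  rw [phi, kernelProd, e, ← Finset.prod_div_distrib, ← Finset.prod_div_distrib,
    ← Finset.prod_div_distrib]
  refine Finset.prod_congr rfl fun j _ => ?_
  rw [← gamma_div_gamma_eq_gammaKernel (h j), div_div, exp_gammaArg]
  have h1 : (α - β j + Real.pi * Complex.I) / (-2 * Real.pi * Complex.I)
      = gammaArg (β j) α - 1 / 2 := by
    rw [gammaArg]
    have := neg_two_pi_I_ne_zero
    field_simp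
    ring
  have h2 : -2 * Real.pi * Complex.I * gammaArg (β j) α = α - β j := by
    linear_combination -gammaArg_mul_two_pi_I (β j) α
  rw [h1, h2]
  rfl

lemma IsContour.psiIntegrand_emW_ae_eq {n : ℕ} {β : Fin (2 * n) → ℂ} {γ : ℝ → ℂ}
    (h : IsContour β γ) (μ ν : Fin 2) (S : {S : Finset (Fin (2 * n)) // S.card = n}) :
    psiIntegrand γ (emW n μ ν β) β S =ᵐ[MeasureTheory.volume] fun t =>
      (((4 * Real.pi ^ 2 : ℂ) ^ (2 * n)) ^ n)⁻¹ * (cConst (2 * n) 2 1 0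
        * ((∑ j, (Complex.exp (-β j))⁻¹) - (-1) ^ (ν : ℕ) * ∑ j, Complex.exp (-β j))) *
      ((-1) ^ ((μ : ℕ) + n) * (∏ j, Complex.exp (-β j))
          * cycleIntegrand γ β S (lowExponents n) t
        + cycleIntegrand γ β S (highExponents n) t) := by
  filter_upwards [ae_forall_apply h.ae_gammaArg_ne_intCast] with t ht
  have h1 : ∏ a, phi β (γ (t a)) / (∏ j, (γ (t a) - β j))
        / ∏ j, (1 - Complex.exp (-γ (t a)) * (Complex.exp (-β j))⁻¹)
      = (∏ a, kernelProd β (γ (t a))) * (((4 * Real.pi ^ 2 : ℂ) ^ (2 * n)) ^ n)⁻¹ := by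
    have e : ((4 * Real.pi ^ 2 : ℂ) ^ (2 * n)) ^ n
        = ∏ _a : Fin n, (4 * Real.pi ^ 2 : ℂ) ^ (2 * n) := by simp
    rw [e, ← div_eq_mul_inv, ← Finset.prod_div_distrib]
    exact Finset.prod_congr rfl fun a _ => phi_div_eq_kernelProd (ht a)
  rw [Finset.prod_div_distrib, Finset.prod_div_distrib] at h1
  have hlow : ∏ a ∈ Finset.univ.filter (fun a : Fin n => (a : ℕ) + 1 < n),
      Complex.exp (-γ (t a)) ^ (2 * (a : ℕ) + 1)
      = ∏ a, Complex.exp (-γ (t a)) ^ lowExponents n a := by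
    rw [Finset.prod_filter]
    refine Finset.prod_congr rfl fun a _ => ?_
    rw [lowExponents]
    split_ifs <;> simp
  have hhigh : ∏ a ∈ Finset.univ.filter (fun a : Fin n => (a : ℕ) + 1 < n),
      Complex.exp (-γ (t a)) ^ (2 * (a : ℕ) + 3)
      = ∏ a, Complex.exp (-γ (t a)) ^ highExponents n a := by
    rw [Finset.prod_filter]
    refine Finset.prod_congr rfl fun a _ => ?_
    rw [highExponents]
    split_ifs <;> simp
  rw [psiIntegrand, wM_eq_wNum_div S (α := fun a => γ (t a)) fun a j => h.ne_rapidity j (t a)]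
  simp only [emW, cycleFn, emCycle, cycleIntegrand]
  rw [hlow, hhigh]
  set E := (∑ j, (Complex.exp (-β j))⁻¹) - (-1) ^ (ν : ℕ) * ∑ j, Complex.exp (-β j)
  set X := ∏ a, Complex.exp (-γ (t a)) ^ lowExponents n a
  set Y := ∏ a, Complex.exp (-γ (t a)) ^ highExponents n a
  set P := cConst (2 * n) 2 1 0 * E * ((-1) ^ ((μ : ℕ) + n) * (∏ j, Complex.exp (-β j)) * X + Y)
  have e : ∀ x a b c d w p : ℂ, x * (a * (w / b) * (p / d)) = x * (a / b / d) * w * p := by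
    intro x a b c d w p
    ring
  rw [e _ _ _ 0, h1]
  simp only [P]
  ring

lemma IsContour.integrable_psiIntegrand_emW {n : ℕ} (hn : 1 ≤ n) {β : Fin (2 * n) → ℂ}
    {γ : ℝ → ℂ} (h : IsContour β γ) (μ ν : Fin 2)
    (S : {S : Finset (Fin (2 * n)) // S.card = n}) :
    MeasureTheory.Integrable (psiIntegrand γ (emW n μ ν β) β S) := by
  refine MeasureTheory.Integrable.congr ?_ (h.psiIntegrand_emW_ae_eq μ ν S).symm
  exact (((h.integrable_cycleIntegrand hn S lowExponents_le).const_mul _).add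
    (h.integrable_cycleIntegrand hn S highExponents_le)).const_mul _

lemma IsContour.integral_psiIntegrand_emW {n : ℕ} (hn : 1 ≤ n) {β : Fin (2 * n) → ℂ}
    {γ : ℝ → ℂ} (h : IsContour β γ) (μ ν : Fin 2)
    (S : {S : Finset (Fin (2 * n)) // S.card = n}) :
    ∫ t, psiIntegrand γ (emW n μ ν β) β S t =
      (((4 * Real.pi ^ 2 : ℂ) ^ (2 * n)) ^ n)⁻¹ * (cConst (2 * n) 2 1 0
        * ((∑ j, (Complex.exp (-β j))⁻¹) - (-1) ^ (ν : ℕ) * ∑ j, Complex.exp (-β j))) *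
      ((-1) ^ ((μ : ℕ) + n) * (∏ j, Complex.exp (-β j)) * cycleIntegral γ β S (lowExponents n)
        + cycleIntegral γ β S (highExponents n)) := by
  rw [MeasureTheory.integral_congr_ae (h.psiIntegrand_emW_ae_eq μ ν S),
    MeasureTheory.integral_const_mul, MeasureTheory.integral_add
      ((h.integrable_cycleIntegrand hn S lowExponents_le).const_mul _)
      (h.integrable_cycleIntegrand hn S highExponents_le), MeasureTheory.integral_const_mul]
  rfl

/-- In `P₀₁ - P₁₀` the products `(∑ B_j) I_low` and `(∑ B_j⁻¹) I_high` cancel; what remains is a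
multiple of the relation between the two monomials. -/
lemma IsContour.psiFn_emW_zero_one {n : ℕ} (hn : 1 ≤ n) {β : Fin (2 * n) → ℂ}
    {γ : ℝ → ℂ} (h : IsContour β γ) :
    psiFn γ (emW n 0 1 β) β = psiFn γ (emW n 1 0 β) β := by
  unfold psiFn
  refine Finset.sum_congr rfl fun S _ => ?_
  congr 1
  rw [h.integral_psiIntegrand_emW hn, h.integral_psiIntegrand_emW hn]
  have hrel := h.cycleIntegral_relation hn S
  simp only [Fin.val_zero, Fin.val_one, pow_zero, pow_one, zero_add, pow_add]
  linear_combination 2 * (((4 * Real.pi ^ 2 : ℂ) ^ (2 * n)) ^ n)⁻¹ * cConst (2 * n) 2 1 0 * hrel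

lemma momentum_zero {N : ℕ} (M : ℝ) (β : Fin N → ℂ) : momentum M β 0
    = M / 2 * ((∑ j, (Complex.exp (-β j))⁻¹) + ∑ j, Complex.exp (-β j)) := by
  rw [← Finset.sum_add_distrib]
  simp only [momentum, Matrix.cons_val_zero, Finset.mul_sum]
  refine Finset.sum_congr rfl fun j _ => ?_
  rw [Complex.cosh, Complex.exp_neg, inv_inv]
  ring

lemma momentum_one {N : ℕ} (M : ℝ) (β : Fin N → ℂ) : momentum M β 1
    = M / 2 * ((∑ j, (Complex.exp (-β j))⁻¹) - ∑ j, Complex.exp (-β j)) := by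
  rw [← Finset.sum_sub_distrib]
  simp only [momentum, Matrix.cons_val_one, Matrix.cons_val_zero, Finset.mul_sum]
  refine Finset.sum_congr rfl fun j _ => ?_
  rw [Complex.sinh, Complex.exp_neg, inv_inv]
  ring

/-- The `ν`-dependent factor is common to both sides. The signs in `p₀`, `p₁` and in `(-1)^μ` make
the same cross terms cancel as in the symmetry statement, leaving a multiple of the same relation.
-/
lemma IsContour.momentum_smul_psiFn_emW {n : ℕ} (hn : 1 ≤ n) {β : Fin (2 * n) → ℂ}
    {γ : ℝ → ℂ} (h : IsContour β γ) (M : ℝ) (ν : Fin 2) :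
    momentum M β 0 • psiFn γ (emW n 0 ν β) β = momentum M β 1 • psiFn γ (emW n 1 ν β) β := by
  unfold psiFn
  rw [Finset.smul_sum, Finset.smul_sum]
  refine Finset.sum_congr rfl fun S _ => ?_
  rw [smul_smul, smul_smul, h.integral_psiIntegrand_emW hn, h.integral_psiIntegrand_emW hn,
    momentum_zero, momentum_one]
  congr 1
  have hrel := h.cycleIntegral_relation hn S
  simp only [Fin.val_zero, Fin.val_one, pow_one, zero_add, pow_add]
  linear_combination M * (((4 * Real.pi ^ 2 : ℂ) ^ (2 * n)) ^ n)⁻¹ * cConst (2 * n) 2 1 0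
    * ((∑ j, (Complex.exp (-β j))⁻¹) - (-1) ^ (ν : ℕ) * ∑ j, Complex.exp (-β j)) * hrel

end SU2ITM

end

theorem mainTheorem5 (n : ℕ) (hn : 1 ≤ n) (M : ℝ) (β : Fin (2 * n) → ℂ) (γ : ℝ → ℂ)
    (hγ : SU2ITM.IsContour β γ) :
    (∀ (μ ν : Fin 2) (S : {S : Finset (Fin (2 * n)) // S.card = n}),
      MeasureTheory.Integrable (SU2ITM.psiIntegrand γ (SU2ITM.emW n μ ν β) β S)) ∧
    (∀ μ ν : Fin 2,
      SU2ITM.emFormFactor M n γ μ ν β = SU2ITM.emFormFactor M n γ ν μ β) ∧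
    (∀ (ν : Fin 2) (x : Fin 2 → ℝ),
      SU2ITM.formFactorDeriv M 0 x β (SU2ITM.emFormFactor M n γ 0 ν β)
        - SU2ITM.formFactorDeriv M 1 x β (SU2ITM.emFormFactor M n γ 1 ν β) = 0) := by
  refine ⟨fun μ ν S => hγ.integrable_psiIntegrand_emW hn μ ν S, fun μ ν => ?_, fun ν x => ?_⟩
  · have h01 := hγ.psiFn_emW_zero_one hn
    unfold SU2ITM.emFormFactor
    congr 1
    fin_cases μ <;> fin_cases ν
    · rfl
    · exact h01
    · exact h01.symm
    · rfl
  · rw [SU2ITM.formFactorDeriv_eq, SU2ITM.formFactorDeriv_eq, sub_eq_zero]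
    unfold SU2ITM.emFormFactor
    have h := hγ.momentum_smul_psiFn_emW hn M ν
    have e : ∀ (a p q c : ℂ) (v : SU2ITM.VTensor (2 * n)),
        (a * p) • (q • (c • v)) = (a * q * c) • (p • v) := by
      intro a p q c v
      simp only [smul_smul]
      congr 1
      ring
    rw [e, e, h]
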